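/- Let $\Omega=(0,1)$, $k\ge 1$, $p_0>0$, $\gamma>0$, and let $-1<G_1<\dots<G_k<1$ be points that are symmetric about $0$, that is $G_{k+1-j}=-G_j$. For a primary mesh $0=x_0<x_1<\dots<x_N=1$ put $K_i=[x_{i-1},x_i]$, $h_i=x_i-x_{i-1}$, $h=\max_i h_i$, and define the dual points $g_{i,j}=\frac12(x_i+x_{i-1}+h_iG_j)$ for $1\le i\le N$, $1\le j\le k$, with $g_{i,k+1}=g_{i+1,1}$ for $i<N$ and $g_{N,k+1}=1$. Let $$U_h^k=\{w\in C(\overline\Omega):\ w|_{K_i}\in P^k(K_i)\ \text{for all } i,\ w(0)=w(1)=0\},\qquad V_h=\Big\{v=\sum_{i=1}^N\sum_{j=1}^k v_{i,j}\,\chi_{[g_{i,j},g_{i,j+1}]}:\ v_{N,k}=0\Big\},$$ and put $v_{1,0}=0$, $v_{i,0}=v_{i-1,k}$ for $i\ge2$, and $[v_{i,j}]=v_{i,j}-v_{i,j-1}$. For coefficients $p,q,r$ with $p\in C([0,1])$, $p\ge p_0$, $q,r\in L^\infty(\Omega)$ and $r-\frac12q'\ge\gamma$ (in the sense of distributions),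 let $$a_h(w,v)=\sum_{i=1}^N\sum_{j=1}^k [v_{i,j}]\,p(g_{i,j})\,w'(g_{i,j})+\sum_{i=1}^N\sum_{j=1}^k v_{i,j}\int_{g_{i,j}}^{g_{i,j+1}}\big(q w'+r w\big)\,dx ,$$ $$\|w\|_1^2=\int_0^1 (w^2+|w'|^2)\,dx,\qquad \|v\|_{\mathcal T_h^*}^2=\sum_{i=1}^N\sum_{j=1}^k\big(h_i^{-1}[v_{i,j}]^2+h_iv_{i,j}^2\big).$$ Then there are constants $c_0>0$ and $C>0$, depending only on $k$, $G_1,\dots,G_k$, $p_0$ and $\gamma$ (the domain $\Omega$ being fixed), such that for all such $p,q,r$ there is an $h_0>0$ with the following property. For every primary mesh with $h<h_0$ (no further condition on the mesh), $$\inf_{0\ne w\in U_h^k}\ \sup_{0\ne v\in V_h}\ \frac{a_h(w,v)}{\|w\|_1\,\|v\|_{\mathcal T_h^*}}\ \ge\ c_0 ,$$ and consequently the scheme is stable: for every $f\in L^2(\Omega)$ there is exactly one $u_h\in U_h^k$ with $a_h(u_h,v)=\int_0^1 f\,v\,dx$ for all $v\in V_h$, and $\|u_h\|_1\le C\,\|f\|_{L^2(\Omega)}$.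 -/

import Mathlib

open MeasureTheory Set
open scoped ContDiff

noncomputable section

namespace FVE

/-- `k` symmetric points `-1 < G_1 < ⋯ < G_k < 1` on the reference element `[-1, 1]`
(indexed from `0`, so that `G j` stands for `G_{j+1}`). They define the dual mesh. -/
structure SymmetricDualPoints (k : ℕ) where
  G : Fin k → ℝ
  strictMono : StrictMono G
  mem_Ioo : ∀ j, G j ∈ Ioo (-1 : ℝ) 1
  symmetric : ∀ j, G (Fin.rev j) = -G j

/-- A primary mesh `0 = x_0 < x_1 < ⋯ < x_N = 1` of `Ω = (0, 1)`. -/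
structure PrimaryMesh where
  N : ℕ
  x : Fin (N + 1) → ℝ
  strictMono : StrictMono x
  x_zero : x 0 = 0
  x_last : x (Fin.last N) = 1

/-- The coefficients of `-(p u')' + q u' + r u = f` on `(0, 1)`: `p` is continuous on `[0, 1]` with
`p ≥ p₀`, the functions `q`, `r` are in `L^∞(0, 1)`, and `r - q'/2 ≥ γ` holds in the sense of
distributions (if `q` has an integrable weak derivative `q'`, this is `r - q'/2 ≥ γ` a.e.). -/
structure AdmissibleCoefficients (p₀ γ : ℝ) (p q r : ℝ → ℝ) : Prop where
  continuousOn_p : ContinuousOn p (Icc 0 1)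
  le_p : ∀ x ∈ Icc (0 : ℝ) 1, p₀ ≤ p x
  memLp_q : MemLp q ⊤ (volume.restrict (Ioo (0 : ℝ) 1))
  memLp_r : MemLp r ⊤ (volume.restrict (Ioo (0 : ℝ) 1))
  le_r_sub : ∀ φ : ℝ → ℝ, ContDiff ℝ ∞ φ → HasCompactSupport φ → tsupport φ ⊆ Ioo 0 1 →
    (∀ x, 0 ≤ φ x) →
    γ * ∫ x in (0 : ℝ)..1, φ x ≤ ∫ x in (0 : ℝ)..1, (r x * φ x + 1 / 2 * (q x * deriv φ x))

namespace PrimaryMesh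

variable (T : PrimaryMesh) {k : ℕ} (D : SymmetricDualPoints k)

/-- The `i`-th element `K = [x_{i-1}, x_i]` (indexed from `0`). -/
def element (i : Fin T.N) : Set ℝ := Icc (T.x i.castSucc) (T.x i.succ)

/-- The length of the `i`-th element. -/
def len (i : Fin T.N) : ℝ := T.x i.succ - T.x i.castSucc

/-- The mesh size `h = max_i h_i`. -/
def meshSize : ℝ := ⨆ i, T.len i

/-- The dual point `g_{i,j}`, the affine image of `G_j` in the `i`-th element. -/
def dualPt (i : Fin T.N) (j : Fin k) : ℝ :=
  (T.x i.succ + T.x i.castSucc + T.len i * D.G j) / 2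

/-- The right end point `g_{i,j+1}` of the control volume `[g_{i,j}, g_{i,j+1}]`, where
`g_{i,k+1} = g_{i+1,1}` for `i < N` and `g_{N,k+1} = 1`. -/
def dualPtNext (i : Fin T.N) (j : Fin k) : ℝ :=
  if hj : j.1 + 1 < k then T.dualPt D i ⟨j.1 + 1, hj⟩
  else if hi : i.1 + 1 < T.N then
    T.dualPt D ⟨i.1 + 1, hi⟩ ⟨0, Nat.lt_of_le_of_lt (Nat.zero_le _) j.2⟩
  else 1

/-- The trial space `U_h^k`: continuous functions, polynomial of degree at most `k` on every
element, which vanish at `0` and `1` (extended by zero outside `(0, 1)`). -/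
def trialSpace (k : ℕ) : Submodule ℝ (ℝ → ℝ) where
  carrier := {w | Continuous w ∧ (∀ x, x ∉ Ioo (0 : ℝ) 1 → w x = 0) ∧
    ∀ i, ∃ P : Polynomial ℝ, P.natDegree ≤ k ∧ ∀ x ∈ T.element i, w x = P.eval x}
  add_mem' := by
    rintro a b ⟨ha, ha0, hap⟩ ⟨hb, hb0, hbp⟩
    refine ⟨ha.add hb, fun x hx => by simp [ha0 x hx, hb0 x hx], fun i => ?_⟩
    obtain ⟨P, hP, hPe⟩ := hap i
    obtain ⟨Q, hQ, hQe⟩ := hbp i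
    exact ⟨P + Q, (Polynomial.natDegree_add_le _ _).trans (max_le hP hQ),
      fun x hx => by simp [hPe x hx, hQe x hx]⟩
  zero_mem' := ⟨continuous_const, fun _ _ => rfl, fun _ => ⟨0, by simp, by simp⟩⟩
  smul_mem' := by
    rintro c a ⟨ha, ha0, hap⟩
    refine ⟨ha.const_smul c, fun x hx => by simp [ha0 x hx], fun i => ?_⟩
    obtain ⟨P, hP, hPe⟩ := hap i
    exact ⟨c • P, (Polynomial.natDegree_smul_le _ _).trans hP, fun x hx => by simp [hPe x hx]⟩

/-- The test space `V_h`: a piecewise constant function on the dual mesh is given by its values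
`v_{i,j}` on the control volumes `[g_{i,j}, g_{i,j+1}]`, with `v_{N,k} = 0`; its value `v_{1,0}` on
`[0, g_{1,1}]` is zero. -/
def testSpace (k : ℕ) : Submodule ℝ (Fin T.N → Fin k → ℝ) where
  carrier := {v | ∀ i j, i.1 + 1 = T.N → j.1 + 1 = k → v i j = 0}
  add_mem' := fun ha hb i j hi hj => by simp [ha i j hi hj, hb i j hi hj]
  zero_mem' := fun _ _ _ _ => rfl
  smul_mem' := fun c _ ha i j hi hj => by simp [ha i j hi hj]

/-- The function `v_h = ∑ v_{i,j} ψ_{i,j}`, with `ψ_{i,j}` the characteristic function of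
`[g_{i,j}, g_{i,j+1}]`. -/
def testFun (v : Fin T.N → Fin k → ℝ) (x : ℝ) : ℝ :=
  ∑ i, ∑ j, v i j * (Icc (T.dualPt D i j) (T.dualPtNext D i j)).indicator (fun _ => (1 : ℝ)) x

variable {T} in
/-- The value `v_{i,j-1}` to the left of `g_{i,j}`, where `v_{i,0} = v_{i-1,k}` and
`v_{1,0} = 0`. -/
def prevVal (v : Fin T.N → Fin k → ℝ) (i : Fin T.N) (j : Fin k) : ℝ :=
  if 0 < j.1 then v i ⟨j.1 - 1, Nat.lt_of_le_of_lt (Nat.sub_le _ _) j.2⟩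
  else if 0 < i.1 then
    v ⟨i.1 - 1, Nat.lt_of_le_of_lt (Nat.sub_le _ _) i.2⟩
      ⟨k - 1, Nat.sub_lt (Nat.lt_of_le_of_lt (Nat.zero_le _) j.2) Nat.one_pos⟩
  else 0

variable {T} in
/-- The jump `[v_{i,j}] = v_{i,j} - v_{i,j-1}` at `g_{i,j}`. -/
def jump (v : Fin T.N → Fin k → ℝ) (i : Fin T.N) (j : Fin k) : ℝ := v i j - prevVal v i j

/-- The bilinear form `a_h(w, v)` of the finite volume element scheme. -/
def bilin (p q r : ℝ → ℝ) (w : ℝ → ℝ) (v : Fin T.N → Fin k → ℝ) : ℝ :=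
  (∑ i, ∑ j, jump v i j * p (T.dualPt D i j) * deriv w (T.dualPt D i j)) +
    ∑ i, ∑ j, v i j *
      ∫ x in (T.dualPt D i j)..(T.dualPtNext D i j), (q x * deriv w x + r x * w x)

/-- The discrete norm `‖v‖_{1,T_h^*}` on the test space. -/
def dualNorm (v : Fin T.N → Fin k → ℝ) : ℝ :=
  Real.sqrt ((∑ i, ∑ j, (T.len i)⁻¹ * jump v i j ^ 2) + ∑ i, ∑ j, T.len i * v i j ^ 2)

end PrimaryMesh

/-- The norm of `L²(0, 1)`. -/
def l2Norm (f : ℝ → ℝ) : ℝ := Real.sqrt (∫ x in (0 : ℝ)..1, f x ^ 2)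

/-- The norm of `H¹(0, 1)`, used for continuous piecewise polynomials `w`, whose weak derivative
is the a.e. defined classical one. -/
def h1Norm (w : ℝ → ℝ) : ℝ :=
  Real.sqrt ((∫ x in (0 : ℝ)..1, w x ^ 2) + ∫ x in (0 : ℝ)..1, deriv w x ^ 2)

end FVE

end

/-!
# Stability of a finite volume element scheme on arbitrary one-dimensional meshes

Let `w` be a trial function, `h` the length of an element, `W` the vector of the values of `w'` at
the `k` dual points of the element, `m` the mean of `W` and `d` the increment of `w` over the
element. The inf-sup condition is proved with an explicit test function `v = testOfTrial w`: the
piecewise constant function on the dual mesh whose jump at the `j`-th dual point of the element is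
`d / k + lam * h * (W j - m)`. These jumps have sum `d`, so that `v` takes the nodal values of `w`
at the ends of the elements; in particular `v` vanishes at `1` and is an admissible test function.

* *Leading term.* For `p = 1` the contribution of an element to the leading term is
  `d * m + lam * h * ∑ (W j - m)²`. Since `w' - m` is a polynomial of degree less than `k`, Lagrange
  interpolation at the dual points gives `|d - h * m| ≤ C * h * |W - m|`, and for a large `lam` the
  contribution is at least `h / (2 * k) * ∑ W j²` (`coercive_jump`), which is equivalent to the `L²`
  norm of `w'` on the element (`element_bounds`). A continuous coefficient `p` is nearly constant on
  every element of a fine mesh (`coercive_jump_weighted`).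
* *Lower order terms.* In the maximum norm `v` differs from `w` by at most a constant times
  `√h * ‖w'‖` (`abs_testOfTrial_sub_le`), hence these terms are a small perturbation of
  `∫ w (q w' + r w)`, which is at least `γ ∫ w²` (`energy_bound`). The hypothesis on `r - q'/2` is
  given for smooth test functions with compact support in `(0, 1)`; it extends to the function `w²`
  by mollification (`weak_bound`).
* *Stability of the test function.* The norm of `v` is bounded by that of `w`
  (`dualNorm_testOfTrial_le`), which turns coercivity into the inf-sup condition
  (`exists_coercive_test`). As `v` is also bounded in the maximum norm by `‖w‖₁`, testing the scheme
  with it bounds the solution by the data.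

The inf-sup condition gives uniqueness. Existence follows by comparing dimensions: the test space is
a proper subspace of a space of dimension `N * k`, and the trial space contains the continuous
functions obtained by gluing `N` polynomials without constraint except for the boundary value at `1`
(`glue`), a space of dimension at least `N * k - 1` (`bilinMap_surjective`).
-/

noncomputable section

namespace FVE

/-! ### Piecewise continuously differentiable functions on the unit interval -/

/-- Continuous functions on `ℝ` which vanish outside `(0, 1)` and have, off a finite set, a
continuous and bounded derivative. This class contains the trial spaces of all meshes and is closed
under products. -/
structure PiecewiseC1 (w : ℝ → ℝ) : Prop where
  continuous : Continuous w
  zero_outside : ∀ x, x ∉ Ioo (0 : ℝ) 1 → w x = 0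
  exists_deriv : ∃ (s : Set ℝ) (M : ℝ), s.Finite ∧ ∀ x, x ∉ s →
    DifferentiableAt ℝ w x ∧ ContinuousAt (deriv w) x ∧ |deriv w x| ≤ M

namespace PiecewiseC1

variable {w w' : ℝ → ℝ}

theorem exists_bound (hw : PiecewiseC1 w) : ∃ B, 0 ≤ B ∧ ∀ x, |w x| ≤ B := by
  have hc : HasCompactSupport w := HasCompactSupport.of_support_subset_isCompact
    (isCompact_Icc (a := (0 : ℝ)) (b := 1)) (fun x hx => by
      by_contra h
      exact hx (hw.zero_outside x fun h' => h (Ioo_subset_Icc_self h')))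
  obtain ⟨B, hB⟩ := hc.exists_bound_of_continuous hw.continuous
  exact ⟨B, (norm_nonneg _).trans (hB 0), fun x => by simpa using hB x⟩

theorem exists_ae_deriv_bound (hw : PiecewiseC1 w) :
    ∃ M, 0 ≤ M ∧ ∀ᵐ x, DifferentiableAt ℝ w x ∧ ContinuousAt (deriv w) x ∧ |deriv w x| ≤ M := by
  obtain ⟨s, M, hs, h⟩ := hw.exists_deriv
  have hae : ∀ᵐ x : ℝ, x ∉ s := hs.countable.ae_notMem _
  refine ⟨max M 0, le_max_right _ _, hae.mono fun x hx => ?_⟩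
  exact ⟨(h x hx).1, (h x hx).2.1, (h x hx).2.2.trans (le_max_left _ _)⟩

theorem intervalIntegrable_deriv (hw : PiecewiseC1 w) (a b : ℝ) :
    IntervalIntegrable (deriv w) volume a b := by
  obtain ⟨M, -, hM⟩ := hw.exists_ae_deriv_bound
  refine (intervalIntegrable_const (c := M)).mono_fun
    (measurable_deriv w).aestronglyMeasurable ?_
  filter_upwards [ae_restrict_of_ae hM] with x hx
  exact hx.2.2.trans (le_abs_self M)

theorem intervalIntegrable_deriv_sq (hw : PiecewiseC1 w) (a b : ℝ) :
    IntervalIntegrable (fun x => deriv w x ^ 2) volume a b := by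
  obtain ⟨M, -, hM⟩ := hw.exists_ae_deriv_bound
  refine (intervalIntegrable_const (c := M ^ 2)).mono_fun
    ((measurable_deriv w).pow_const 2).aestronglyMeasurable ?_
  filter_upwards [ae_restrict_of_ae hM] with x hx
  simp only [norm_pow, Real.norm_eq_abs]
  exact pow_le_pow_left₀ (abs_nonneg _) (hx.2.2.trans (le_abs_self M)) 2

theorem integral_deriv (hw : PiecewiseC1 w) (a b : ℝ) :
    ∫ x in a..b, deriv w x = w b - w a := by
  obtain ⟨s, M, hs, h⟩ := hw.exists_deriv
  exact MeasureTheory.integral_eq_of_hasDerivAt_off_countable w (deriv w) hs.countable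
    hw.continuous.continuousOn (fun x hx => (h x hx.2).1.hasDerivAt)
    (hw.intervalIntegrable_deriv a b)

theorem exists_lipschitz (hw : PiecewiseC1 w) :
    ∃ M, 0 ≤ M ∧ (∀ x y, |w x - w y| ≤ M * |x - y|) ∧
      ∀ᵐ x, DifferentiableAt ℝ w x ∧ ContinuousAt (deriv w) x ∧ |deriv w x| ≤ M := by
  obtain ⟨M, hM0, hM⟩ := hw.exists_ae_deriv_bound
  refine ⟨M, hM0, fun x y => ?_, hM⟩
  rw [← hw.integral_deriv y x, ← Real.norm_eq_abs]
  refine intervalIntegral.norm_integral_le_of_norm_le_const_ae ?_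
  filter_upwards [hM] with t ht _ using ht.2.2

theorem mul (hw : PiecewiseC1 w) (hw' : PiecewiseC1 w') : PiecewiseC1 (w * w') := by
  obtain ⟨s, M, hs, h⟩ := hw.exists_deriv
  obtain ⟨s', M', hs', h'⟩ := hw'.exists_deriv
  obtain ⟨B, hB0, hB⟩ := hw.exists_bound
  obtain ⟨B', hB0', hB'⟩ := hw'.exists_bound
  refine ⟨hw.continuous.mul hw'.continuous, fun x hx => by
    simp [hw.zero_outside x hx], s ∪ s', M * B' + B * M', hs.union hs', ?_⟩
  intro x hx
  have h1 := h x fun h => hx (Or.inl h)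
  have h2 := h' x fun h => hx (Or.inr h)
  have ho : (s ∪ s')ᶜ ∈ nhds x := (hs.union hs').isClosed.isOpen_compl.mem_nhds hx
  have he : deriv (w * w') =ᶠ[nhds x] fun y => deriv w y * w' y + w y * deriv w' y := by
    filter_upwards [ho] with y hy
    exact deriv_mul (h y fun h => hy (Or.inl h)).1 (h' y fun h => hy (Or.inr h)).1
  refine ⟨h1.1.mul h2.1, ((h1.2.1.mul hw'.continuous.continuousAt).add
    (hw.continuous.continuousAt.mul h2.2.1)).congr he.symm, ?_⟩
  rw [he.eq_of_nhds]
  refine (abs_add_le _ _).trans ?_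
  rw [abs_mul, abs_mul]
  exact add_le_add
    (mul_le_mul h1.2.2 (hB' x) (abs_nonneg _) ((abs_nonneg _).trans h1.2.2))
    (mul_le_mul (hB x) h2.2.2 (abs_nonneg _) hB0)

end PiecewiseC1

/-- The Cauchy–Schwarz inequality against the constant function `1`. -/
theorem sq_integral_le {f : ℝ → ℝ} {a b : ℝ} (hab : a ≤ b)
    (hf : IntervalIntegrable f volume a b)
    (hf2 : IntervalIntegrable (fun x => f x ^ 2) volume a b) :
    (∫ x in a..b, f x) ^ 2 ≤ (b - a) * ∫ x in a..b, f x ^ 2 := by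
  rcases hab.eq_or_lt with rfl | hlt
  · simp
  have hba : 0 < b - a := sub_pos.2 hlt
  set I := ∫ x in a..b, f x with hI
  -- Expand `0 ≤ ∫ (f - t)²` with the mean value `t` of `f`.
  set t := I / (b - a) with ht
  have h0 : 0 ≤ ∫ x in a..b, (f x - t) ^ 2 :=
    intervalIntegral.integral_nonneg hab fun x _ => sq_nonneg _
  have h1 : ∫ x in a..b, (f x - t) ^ 2 = (∫ x in a..b, f x ^ 2) - 2 * t * I + t ^ 2 * (b - a) := by
    have : (fun x => (f x - t) ^ 2) = fun x => (f x ^ 2 - 2 * t * f x) + t ^ 2 := by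
      funext x; ring
    rw [this, intervalIntegral.integral_add (hf2.sub (hf.const_mul _)) intervalIntegrable_const,
      intervalIntegral.integral_sub hf2 (hf.const_mul _), intervalIntegral.integral_const_mul,
      intervalIntegral.integral_const, smul_eq_mul]
    ring
  have htI : t * (b - a) = I := div_mul_cancel₀ _ hba.ne'
  rw [h1] at h0
  have := mul_nonneg hba.le h0
  nlinarith

theorem PiecewiseC1.sq_sub_le {w : ℝ → ℝ} (hw : PiecewiseC1 w) {x y : ℝ}
    (hx : 0 ≤ x) (hxy : x ≤ y) (hy : y ≤ 1) :
    (w y - w x) ^ 2 ≤ (y - x) * ∫ t in (0 : ℝ)..1, deriv w t ^ 2 := by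
  rw [← hw.integral_deriv x y]
  refine (sq_integral_le hxy (hw.intervalIntegrable_deriv _ _)
    (hw.intervalIntegrable_deriv_sq _ _)).trans ?_
  refine mul_le_mul_of_nonneg_left ?_ (sub_nonneg.2 hxy)
  exact intervalIntegral.integral_mono_interval hx hxy hy
    (Filter.Eventually.of_forall fun x => sq_nonneg _) (hw.intervalIntegrable_deriv_sq _ _)

/-! ### Mollification and the weak lower bound on `r - q'/2` -/

/-- The convolution with a normed bump function. -/
def mollify (ρ : ContDiffBump (0 : ℝ)) (g : ℝ → ℝ) : ℝ → ℝ :=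
  convolution (ρ.normed volume) g (ContinuousLinearMap.lsmul ℝ ℝ) volume

theorem mollify_apply (ρ : ContDiffBump (0 : ℝ)) (g : ℝ → ℝ) (x : ℝ) :
    mollify ρ g x = ∫ t, ρ.normed volume t * g (x - t) := by
  simp [mollify, convolution]

theorem abs_mollify_le (ρ : ContDiffBump (0 : ℝ)) {g : ℝ → ℝ} {B : ℝ}
    (hB : ∀ᵐ x, |g x| ≤ B) (x : ℝ) : |mollify ρ g x| ≤ B := by
  rw [mollify_apply]
  have hB' : ∀ᵐ t, |g (x - t)| ≤ B :=
    (quasiMeasurePreserving_sub_left volume x).ae hB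
  calc |∫ t, ρ.normed volume t * g (x - t)| ≤ ∫ t, ρ.normed volume t * B := by
        rw [← Real.norm_eq_abs]
        refine norm_integral_le_of_norm_le ((ρ.integrable_normed (μ := volume)).mul_const B) ?_
        filter_upwards [hB'] with t ht
        rw [norm_mul, Real.norm_of_nonneg (ρ.nonneg_normed t)]
        exact mul_le_mul_of_nonneg_left ht (ρ.nonneg_normed t)
    _ = B := by rw [integral_mul_const, ρ.integral_normed, one_mul]

theorem hasDerivAt_mollify (ρ : ContDiffBump (0 : ℝ)) {w : ℝ → ℝ} (hw : PiecewiseC1 w) (x : ℝ) :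
    HasDerivAt (mollify ρ w) (mollify ρ (deriv w) x) x := by
  obtain ⟨M, hM0, hL, hM⟩ := hw.exists_lipschitz
  have hfun : mollify ρ w = fun x => ∫ t, ρ.normed volume t * w (x - t) :=
    funext (mollify_apply ρ w)
  rw [hfun, mollify_apply]
  have hcont : ∀ y, Continuous fun t => ρ.normed volume t * w (y - t) := fun y =>
    ρ.continuous_normed.mul (hw.continuous.comp (continuous_const.sub continuous_id))
  refine (hasDerivAt_integral_of_dominated_loc_of_lip (s := univ)
    (bound := fun t => ρ.normed volume t * M) Filter.univ_mem
    (Filter.Eventually.of_forall fun y => (hcont y).aestronglyMeasurable)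
    ((hcont x).integrable_of_hasCompactSupport ρ.hasCompactSupport_normed.mul_right)
    (ρ.continuous_normed.measurable.mul
      ((measurable_deriv w).comp (measurable_const.sub measurable_id))).aestronglyMeasurable
    ?_ (ρ.integrable_normed.mul_const M) ?_).2
  · refine Filter.Eventually.of_forall fun t => LipschitzOnWith.of_dist_le_mul fun a _ b _ => ?_
    have h0 := ρ.nonneg_normed (μ := volume) t
    rw [Real.dist_eq, Real.dist_eq, ← mul_sub, abs_mul, Real.coe_nnabs, abs_of_nonneg h0,
      abs_of_nonneg (mul_nonneg h0 hM0), mul_assoc]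
    refine mul_le_mul_of_nonneg_left ?_ h0
    have := hL (a - t) (b - t)
    rwa [sub_sub_sub_cancel_right] at this
  · filter_upwards [(quasiMeasurePreserving_sub_left volume x).ae hM] with t ht
    have h1 : HasDerivAt (fun y => w (y - t)) (deriv w (x - t)) x := by
      simpa using ht.1.hasDerivAt.comp_sub_const x t
    exact h1.const_mul _

theorem exists_ae_bound {q : ℝ → ℝ} (hq : MemLp q ⊤ (volume.restrict (Ioo (0 : ℝ) 1))) :
    ∃ Q, 0 ≤ Q ∧ ∀ᵐ x ∂(volume.restrict (Ioc (0 : ℝ) 1)), |q x| ≤ Q := by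
  rw [restrict_Ioo_eq_restrict_Ioc] at hq
  exact ⟨_, lpNorm_nonneg, ae_le_lpNorm_exponent_top hq⟩

theorem integrable_mul_of_ae_bound {q g : ℝ → ℝ} {M : ℝ}
    (hq : MemLp q ⊤ (volume.restrict (Ioo (0 : ℝ) 1))) (hg : Measurable g)
    (hM : ∀ᵐ x, |g x| ≤ M) : IntervalIntegrable (fun x => q x * g x) volume 0 1 := by
  obtain ⟨Q, hQ0, hQ⟩ := exists_ae_bound hq
  rw [restrict_Ioo_eq_restrict_Ioc] at hq
  rw [← uIoc_of_le zero_le_one] at hq hQ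
  refine (intervalIntegrable_const (c := Q * M)).mono_fun
    (hq.1.mul hg.aestronglyMeasurable) ?_
  filter_upwards [hQ, ae_restrict_of_ae hM] with x h1 h2
  rw [norm_mul]
  exact (mul_le_mul h1 h2 (abs_nonneg _) hQ0).trans (le_abs_self _)

/-- The affine dilation about `1/2` which maps a compact subinterval of `(0, 1)` onto
`[-δ, 1 + δ]`. -/
def dilate (δ x : ℝ) : ℝ := 1 / 2 + (x - 1 / 2) * (1 + 4 * δ)

theorem hasDerivAt_dilate (δ x : ℝ) : HasDerivAt (dilate δ) (1 + 4 * δ) x := by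
  have h := (((hasDerivAt_id' x).sub_const (1 / 2)).mul_const (1 + 4 * δ)).const_add (1 / 2)
  rw [one_mul] at h
  exact h

theorem contDiff_dilate (δ : ℝ) : ContDiff ℝ ∞ (dilate δ) := by
  unfold dilate; fun_prop

theorem mollify_dilate_eq_zero (ρ : ContDiffBump (0 : ℝ)) {w : ℝ → ℝ} (hw : PiecewiseC1 w) {x : ℝ}
    (hx : x ∉ Icc (ρ.rOut / (1 + 4 * ρ.rOut)) (1 - ρ.rOut / (1 + 4 * ρ.rOut))) :
    mollify ρ w (dilate ρ.rOut x) = 0 := by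
  have hδ := ρ.rOut_pos
  have hd : (0 : ℝ) < 1 + 4 * ρ.rOut := by linarith
  rw [mollify_apply]
  refine integral_eq_zero_of_ae (Filter.Eventually.of_forall fun t => ?_)
  show ρ.normed volume t * w (dilate ρ.rOut x - t) = 0
  by_cases ht : t ∈ Metric.ball (0 : ℝ) ρ.rOut
  · rw [hw.zero_outside, mul_zero]
    rintro ⟨h1, h2⟩
    apply hx
    rw [Metric.mem_ball, dist_zero_right, Real.norm_eq_abs, abs_lt] at ht
    simp only [dilate] at h1 h2
    constructor
    · rw [div_le_iff₀ hd]; nlinarith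
    · rw [le_sub_comm, div_le_iff₀ hd]; nlinarith
  · rw [← ρ.support_normed_eq (μ := volume), Function.notMem_support] at ht
    rw [ht, zero_mul]

/-- The weak inequality `r - q'/2 ≥ γ` may be tested with nonnegative piecewise `C¹` functions:
these are limits in `W^{1,1}` of smooth nonnegative functions supported in `(0, 1)`, obtained by
mollifying and then squeezing the support back into `(0, 1)` by a dilation. -/
theorem AdmissibleCoefficients.weak_bound {p₀ γ : ℝ} {p q r : ℝ → ℝ}
    (h : AdmissibleCoefficients p₀ γ p q r) {φ : ℝ → ℝ} (hφ : PiecewiseC1 φ) (h0 : ∀ x, 0 ≤ φ x) :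
    γ * ∫ x in (0 : ℝ)..1, φ x ≤ ∫ x in (0 : ℝ)..1, (r x * φ x + 1 / 2 * (q x * deriv φ x)) := by
  obtain ⟨M, hM0, hL, hM⟩ := hφ.exists_lipschitz
  obtain ⟨B, hB0, hB⟩ := hφ.exists_bound
  obtain ⟨Q, hQ0, hQ⟩ := exists_ae_bound h.memLp_q
  obtain ⟨R, hR0, hR⟩ := exists_ae_bound h.memLp_r
  have hMd : ∀ᵐ x, |deriv φ x| ≤ M := hM.mono fun x hx => hx.2.2
  let δ : ℕ → ℝ := fun n => 1 / ((n : ℝ) + 1)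
  have hδ : ∀ n, 0 < δ n := fun n => Nat.one_div_pos_of_nat
  have hδ1 : ∀ n, δ n ≤ 1 := fun n => by
    rw [div_le_one (by positivity)]; linarith [n.cast_nonneg (α := ℝ)]
  have hδt : Filter.Tendsto δ Filter.atTop (nhds 0) := tendsto_one_div_add_atTop_nhds_zero_nat
  let ρ : ℕ → ContDiffBump (0 : ℝ) := fun n => ⟨δ n / 2, δ n, half_pos (hδ n), half_lt_self (hδ n)⟩
  -- The derivatives of `ψ n` converge at every point where that of `φ` is continuous, and they are
  -- uniformly bounded, so that both integrals pass to the limit.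
  let ψ : ℕ → ℝ → ℝ := fun n x => mollify (ρ n) φ (dilate (δ n) x)
  have hderiv : ∀ n x, deriv (ψ n) x = mollify (ρ n) (deriv φ) (dilate (δ n) x) * (1 + 4 * δ n) :=
    fun n x => ((hasDerivAt_mollify (ρ n) hφ _).comp x (hasDerivAt_dilate (δ n) x)).deriv
  have hsmooth : ∀ n, ContDiff ℝ ∞ (ψ n) := fun n => by
    have h1 : ContDiff ℝ ∞ (mollify (ρ n) φ) :=
      (ρ n).hasCompactSupport_normed.contDiff_convolution_left _ (ρ n).contDiff_normed
        hφ.continuous.locallyIntegrable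
    exact h1.comp (contDiff_dilate (δ n))
  have htest : ∀ n, γ * ∫ x in (0 : ℝ)..1, ψ n x ≤
      ∫ x in (0 : ℝ)..1, (r x * ψ n x + 1 / 2 * (q x * deriv (ψ n) x)) := fun n => by
    have hsub : tsupport (ψ n) ⊆ Icc (δ n / (1 + 4 * δ n)) (1 - δ n / (1 + 4 * δ n)) :=
      closure_minimal (fun x hx => by
        by_contra hx'
        exact hx (mollify_dilate_eq_zero (ρ n) hφ hx')) isClosed_Icc
    have hpos : 0 < δ n / (1 + 4 * δ n) := div_pos (hδ n) (by linarith [hδ n])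
    refine h.le_r_sub (ψ n) (hsmooth n)
      (isCompact_Icc.of_isClosed_subset (isClosed_tsupport _) hsub)
      (fun x hx => ⟨hpos.trans_le (hsub hx).1, (hsub hx).2.trans_lt (by linarith)⟩) fun x => ?_
    simp only [ψ, mollify_apply]
    exact integral_nonneg fun t => mul_nonneg ((ρ n).nonneg_normed t) (h0 _)
  have hdil : ∀ x, Filter.Tendsto (fun n => dilate (δ n) x) Filter.atTop (nhds x) := fun x => by
    have : Filter.Tendsto (fun n => 1 / 2 + (x - 1 / 2) * (1 + 4 * δ n)) Filter.atTop
        (nhds (1 / 2 + (x - 1 / 2) * (1 + 4 * 0))) :=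
      (((hδt.const_mul 4).const_add 1).const_mul _).const_add _
    simpa [dilate] using this
  have hlim : ∀ {g : ℝ → ℝ} {x : ℝ}, Measurable g → ContinuousAt g x →
      Filter.Tendsto (fun n => mollify (ρ n) g (dilate (δ n) x)) Filter.atTop (nhds (g x)) := by
    intro g x hg hgx
    exact ContDiffBump.convolution_tendsto_right (g := fun _ => g) hδt
      (Filter.Eventually.of_forall fun _ => hg.aestronglyMeasurable)
      (hgx.tendsto.comp Filter.tendsto_snd) (hdil x)
  have hlimψ : ∀ x, Filter.Tendsto (fun n => ψ n x) Filter.atTop (nhds (φ x)) := fun x =>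
    hlim hφ.continuous.measurable hφ.continuous.continuousAt
  have hlimd : ∀ᵐ x, Filter.Tendsto (fun n => deriv (ψ n) x) Filter.atTop (nhds (deriv φ x)) := by
    filter_upwards [hM] with x hx
    simp only [hderiv]
    simpa using (hlim (measurable_deriv φ) hx.2.1).mul ((hδt.const_mul 4).const_add 1)
  have hψB : ∀ n x, |ψ n x| ≤ B := fun n x =>
    abs_mollify_le (ρ n) (Filter.Eventually.of_forall hB) _
  have hψd : ∀ n x, |deriv (ψ n) x| ≤ M * 5 := fun n x => by
    rw [hderiv, abs_mul]
    refine mul_le_mul (abs_mollify_le (ρ n) hMd _) ?_ (abs_nonneg _) hM0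
    rw [abs_of_pos (by linarith [hδ n])]; linarith [hδ1 n]
  have hmeas : ∀ n, Measurable (ψ n) := fun n => (hsmooth n).continuous.measurable
  have hlhs : Filter.Tendsto (fun n => γ * ∫ x in (0 : ℝ)..1, ψ n x) Filter.atTop
      (nhds (γ * ∫ x in (0 : ℝ)..1, φ x)) := by
    refine Filter.Tendsto.const_mul _ ?_
    exact intervalIntegral.tendsto_integral_filter_of_dominated_convergence (fun _ => B)
      (Filter.Eventually.of_forall fun n => (hmeas n).aestronglyMeasurable)
      (Filter.Eventually.of_forall fun n => Filter.Eventually.of_forall fun x _ => hψB n x)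
      intervalIntegrable_const (Filter.Eventually.of_forall fun x _ => hlimψ x)
  have hq := h.memLp_q.1
  have hr := h.memLp_r.1
  rw [restrict_Ioo_eq_restrict_Ioc, ← uIoc_of_le zero_le_one] at hq hr
  rw [← uIoc_of_le zero_le_one, ae_restrict_iff' measurableSet_uIoc] at hQ hR
  refine le_of_tendsto_of_tendsto' hlhs ?_ htest
  refine intervalIntegral.tendsto_integral_filter_of_dominated_convergence
    (fun _ => R * B + 1 / 2 * (Q * (M * 5)))
    (Filter.Eventually.of_forall fun n => (hr.mul (hmeas n).aestronglyMeasurable).add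
      ((hq.mul (measurable_deriv _).aestronglyMeasurable).const_mul _))
    (Filter.Eventually.of_forall fun n => ?_) intervalIntegrable_const ?_
  · filter_upwards [hQ, hR] with x hxQ hxR hx
    refine (norm_add_le _ _).trans (add_le_add ?_ ?_)
    · rw [norm_mul]
      exact mul_le_mul (hxR hx) (hψB n x) (abs_nonneg _) hR0
    · rw [norm_mul, norm_mul, Real.norm_of_nonneg (by norm_num : (0 : ℝ) ≤ 1 / 2)]
      exact mul_le_mul_of_nonneg_left
        (mul_le_mul (hxQ hx) (hψd n x) (abs_nonneg _) hQ0) (by norm_num)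
  · filter_upwards [hlimd] with x hx _
    exact ((hlimψ x).const_mul _).add ((hx.const_mul _).const_mul _)

/-- Coercivity of the lower order terms: the weak bound on `r - q'/2`, tested with `w²`. -/
theorem AdmissibleCoefficients.energy_bound {p₀ γ : ℝ} {p q r : ℝ → ℝ}
    (h : AdmissibleCoefficients p₀ γ p q r) {w : ℝ → ℝ} (hw : PiecewiseC1 w) :
    γ * ∫ x in (0 : ℝ)..1, w x ^ 2 ≤
      ∫ x in (0 : ℝ)..1, w x * (q x * deriv w x + r x * w x) := by
  obtain ⟨M, hM0, hM⟩ := hw.exists_ae_deriv_bound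
  have h1 := h.weak_bound (hw.mul hw) fun x => mul_self_nonneg (w x)
  have h2 : ∀ x, (w * w) x = w x ^ 2 := fun x => by simp [sq]
  simp only [h2] at h1
  refine h1.trans_eq (intervalIntegral.integral_congr_ae ?_)
  filter_upwards [hM] with x hx _
  rw [deriv_mul hx.1 hx.1]
  ring

/-! ### Polynomials on one element -/

namespace SymmetricDualPoints

variable {k : ℕ} (D : SymmetricDualPoints k)

/-- The Lagrange basis polynomial of the point `G j`. -/
def lagrange (j : Fin k) : Polynomial ℝ := Lagrange.basis Finset.univ D.G j

theorem eval_lagrange (i j : Fin k) : (D.lagrange i).eval (D.G j) = if i = j then 1 else 0 := by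
  unfold lagrange
  split_ifs with h
  · subst h
    exact Lagrange.eval_basis_self D.strictMono.injective.injOn (Finset.mem_univ _)
  · exact Lagrange.eval_basis_of_ne h (Finset.mem_univ _)

theorem eval_eq_sum_lagrange {R : Polynomial ℝ} (hR : R.degree < k) (t : ℝ) :
    R.eval t = ∑ j, R.eval (D.G j) * (D.lagrange j).eval t := by
  conv_lhs => rw [Lagrange.eq_interpolate_of_eval_eq (s := Finset.univ) (v := D.G)
    (fun j => R.eval (D.G j)) D.strictMono.injective.injOn (by simpa using hR) (fun _ _ => rfl)]
  simp [Lagrange.interpolate_apply, Polynomial.eval_finsetSum, lagrange]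

theorem exists_abs_eval_le : ∃ Λ : ℝ, 0 < Λ ∧ ∀ R : Polynomial ℝ, R.degree < k →
    ∀ t ∈ Icc (-1 : ℝ) 1, |R.eval t| ≤ Λ * ∑ j, |R.eval (D.G j)| := by
  have h : ∀ j, ∃ B, ∀ t ∈ Icc (-1 : ℝ) 1, |(D.lagrange j).eval t| ≤ B := fun j => by
    obtain ⟨B, hB⟩ := isCompact_Icc.exists_bound_of_continuousOn (s := Icc (-1 : ℝ) 1)
      (f := fun t => (D.lagrange j).eval t) (Polynomial.continuous _).continuousOn
    exact ⟨B, hB⟩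
  choose B hB using h
  refine ⟨1 + ∑ j, |B j|, by positivity, fun R hR t ht => ?_⟩
  rw [D.eval_eq_sum_lagrange hR, Finset.mul_sum]
  refine (Finset.abs_sum_le_sum_abs _ _).trans (Finset.sum_le_sum fun j _ => ?_)
  rw [abs_mul, mul_comm]
  refine mul_le_mul_of_nonneg_right ?_ (abs_nonneg _)
  have h1 := Finset.single_le_sum (f := fun j => |B j|) (fun _ _ => abs_nonneg _)
    (Finset.mem_univ j)
  have h2 := (hB j t ht).trans (le_abs_self _)
  linarith

/-- On polynomials of degree less than `k` the values at the dual points are controlled by the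
`L²` norm: the square of the latter is a positive definite quadratic form in the former. -/
theorem exists_sum_sq_le : ∃ C : ℝ, 0 < C ∧ ∀ R : Polynomial ℝ, R.degree < k →
    ∑ j, R.eval (D.G j) ^ 2 ≤ C * ∫ t in (-1 : ℝ)..1, R.eval t ^ 2 := by
  let P : (Fin k → ℝ) → ℝ → ℝ := fun W t => ∑ j, W j * (D.lagrange j).eval t
  let Q : (Fin k → ℝ) → ℝ := fun W => ∫ t in (-1 : ℝ)..1, P W t ^ 2
  have hPc : Continuous (Function.uncurry fun W t => P W t ^ 2) := by
    refine Continuous.pow (continuous_finsetSum _ fun j _ => Continuous.mul ?_ ?_) 2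
    · exact (continuous_apply j).comp continuous_fst
    · exact (Polynomial.continuous _).comp continuous_snd
  have hQc : Continuous Q := by
    exact intervalIntegral.continuous_parametric_intervalIntegral_of_continuous' hPc _ _
  have hPG : ∀ W j, P W (D.G j) = W j := fun W j => by
    simp [P, D.eval_lagrange]
  have hQpos : ∀ W ∈ Metric.sphere (0 : Fin k → ℝ) 1, 0 < Q W := fun W hW => by
    have hW0 : W ≠ 0 := by
      rintro rfl; simp at hW
    obtain ⟨j, hj⟩ := Function.ne_iff.1 hW0
    refine intervalIntegral.integral_pos (by norm_num)
      (hPc.comp (Continuous.prodMk_right W)).continuousOn (fun t _ => sq_nonneg _)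
      ⟨D.G j, Ioo_subset_Icc_self (D.mem_Ioo j), ?_⟩
    rw [hPG]
    exact sq_pos_of_ne_zero hj
  -- A continuous function that is positive on the unit sphere is bounded below there.
  obtain ⟨c, hc, hcQ⟩ := (isCompact_sphere (0 : Fin k → ℝ) 1).exists_forall_le'
    hQc.continuousOn hQpos
  have hQ : ∀ W, c * ‖W‖ ^ 2 ≤ Q W := fun W => by
    by_cases hW : W = 0
    · subst hW; simp [Q, P]
    have hn : ‖W‖ ≠ 0 := norm_ne_zero_iff.2 hW
    have h1 := hcQ (‖W‖⁻¹ • W) (by simp [norm_smul, hn])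
    have h2 : Q (‖W‖⁻¹ • W) = (‖W‖⁻¹) ^ 2 * Q W := by
      simp only [Q]
      rw [← intervalIntegral.integral_const_mul]
      congr 1; funext t
      rw [← mul_pow]
      simp only [P, Finset.mul_sum, Pi.smul_apply, smul_eq_mul, mul_assoc]
    rw [h2, inv_pow, inv_mul_eq_div, le_div_iff₀ (by positivity)] at h1
    exact h1
  refine ⟨(k + 1) / c, by positivity, fun R hR => ?_⟩
  have h1 := hQ fun j => R.eval (D.G j)
  have h2 : Q (fun j => R.eval (D.G j)) = ∫ t in (-1 : ℝ)..1, R.eval t ^ 2 := by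
    simp only [Q, P, ← D.eval_eq_sum_lagrange hR]
  rw [h2] at h1
  have h3 : ∑ j, R.eval (D.G j) ^ 2 ≤ k * ‖fun j => R.eval (D.G j)‖ ^ 2 := by
    have : ∀ j ∈ Finset.univ, R.eval (D.G j) ^ 2 ≤ ‖fun j => R.eval (D.G j)‖ ^ 2 := fun j _ => by
      rw [← sq_abs]
      exact pow_le_pow_left₀ (abs_nonneg _) (norm_le_pi_norm (fun j => R.eval (D.G j)) j) 2
    simpa using Finset.sum_le_card_nsmul _ _ _ this
  rw [div_mul_eq_mul_div, le_div_iff₀ hc]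
  have h4 : (0 : ℝ) ≤ k := k.cast_nonneg
  have h5 := sq_nonneg ‖fun j => R.eval (D.G j)‖
  nlinarith [mul_le_mul_of_nonneg_left h1 h4, mul_le_mul_of_nonneg_right h3 hc.le,
    mul_nonneg hc.le h5]

/-- The affine image of the `j`-th dual point in the interval `[a, b]`. -/
def pt (a b : ℝ) (j : Fin k) : ℝ := (b + a + (b - a) * D.G j) / 2

variable {D} in
theorem pt_mem_Ioo {a b : ℝ} (hab : a < b) (j : Fin k) : D.pt a b j ∈ Ioo a b := by
  obtain ⟨h1, h2⟩ := D.mem_Ioo j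
  unfold pt
  constructor <;> nlinarith

/-- Pull-back of a polynomial from `[a, b]` to `[-1, 1]`. -/
def pullback (a b : ℝ) (R : Polynomial ℝ) : Polynomial ℝ :=
  R.comp (Polynomial.C ((b - a) / 2) * Polynomial.X + Polynomial.C ((b + a) / 2))

theorem degree_pullback_lt (a b : ℝ) {R : Polynomial ℝ} (hR : R.degree < k) :
    (pullback a b R).degree < k := by
  by_cases h0 : pullback a b R = 0
  · rw [h0, Polynomial.degree_zero]; exact WithBot.bot_lt_coe _
  have hR0 : R ≠ 0 := by
    rintro rfl; simp [pullback] at h0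
  rw [← Polynomial.natDegree_lt_iff_degree_lt hR0] at hR
  rw [← Polynomial.natDegree_lt_iff_degree_lt h0]
  refine (Polynomial.natDegree_comp_le.trans ?_).trans_lt hR
  exact (Nat.mul_le_mul_left _ Polynomial.natDegree_linear_le).trans_eq (mul_one _)

theorem eval_pullback (a b : ℝ) (R : Polynomial ℝ) (t : ℝ) :
    (pullback a b R).eval t = R.eval ((b - a) / 2 * t + (b + a) / 2) := by
  simp [pullback]

theorem eval_pullback_G (a b : ℝ) (R : Polynomial ℝ) (j : Fin k) :
    (pullback a b R).eval (D.G j) = R.eval (D.pt a b j) := by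
  rw [eval_pullback, pt]; congr 1; ring

/-- `Λ` is a constant for the maximum norm and `L²` nodal estimates, on every interval: the latter
bounds the nodal values by the `L²` norm, with the scaling of the interval. -/
def IsNodalBound (Λ : ℝ) : Prop :=
  ∀ a b : ℝ, a < b → ∀ R : Polynomial ℝ, R.degree < k →
    (∀ x ∈ Icc a b, |R.eval x| ≤ Λ * ∑ j, |R.eval (D.pt a b j)|) ∧
    (b - a) * ∑ j, R.eval (D.pt a b j) ^ 2 ≤ Λ * ∫ x in a..b, R.eval x ^ 2

theorem exists_isNodalBound : ∃ Λ : ℝ, 0 < Λ ∧ D.IsNodalBound Λ := by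
  obtain ⟨Λ, hΛ, h1⟩ := D.exists_abs_eval_le
  obtain ⟨C, hC, h2⟩ := D.exists_sum_sq_le
  have hm : ∀ c, 0 ≤ c → Λ * c ≤ (Λ + 2 * C) * c ∧ 2 * C * c ≤ (Λ + 2 * C) * c := fun c hc => by
    constructor <;> nlinarith [mul_nonneg hΛ.le hc, mul_nonneg hC.le hc]
  refine ⟨Λ + 2 * C, by positivity, fun a b hab R hR => ⟨fun x hx => ?_, ?_⟩⟩
  · have hba : 0 < b - a := sub_pos.2 hab
    have h := h1 (pullback a b R) (degree_pullback_lt a b hR) ((2 * x - (b + a)) / (b - a)) (by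
      rw [mem_Icc, le_div_iff₀ hba, div_le_iff₀ hba]
      constructor <;> linarith [hx.1, hx.2])
    have he : (b - a) / 2 * ((2 * x - (b + a)) / (b - a)) + (b + a) / 2 = x := by
      field_simp; ring
    simp only [eval_pullback_G] at h
    rw [eval_pullback, he] at h
    exact h.trans (hm _ (Finset.sum_nonneg fun _ _ => abs_nonneg _)).1
  · have hba : 0 < b - a := sub_pos.2 hab
    have h := h2 (pullback a b R) (degree_pullback_lt a b hR)
    simp only [eval_pullback_G] at h
    simp only [eval_pullback] at h
    have hI := intervalIntegral.mul_integral_comp_mul_add (f := fun x => R.eval x ^ 2)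
      ((b - a) / 2) ((b + a) / 2) (a := -1) (b := 1)
    have ea : (b - a) / 2 * -1 + (b + a) / 2 = a := by ring
    have eb : (b - a) / 2 * 1 + (b + a) / 2 = b := by ring
    rw [ea, eb] at hI
    have hpos : 0 ≤ ∫ x in a..b, R.eval x ^ 2 :=
      intervalIntegral.integral_nonneg hab.le fun _ _ => sq_nonneg _
    refine le_trans ?_ (hm _ hpos).2
    rw [← hI]
    nlinarith [mul_le_mul_of_nonneg_left h hba.le]

end SymmetricDualPoints

/-! ### Geometry of the primary and the dual mesh -/

theorem sum_next_sub {n : ℕ} (hn : 0 < n) (g next : Fin n → ℝ) (e : ℝ)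
    (h : ∀ j : Fin n, next j = if hj : j.1 + 1 < n then g ⟨j.1 + 1, hj⟩ else e) :
    ∑ j, (next j - g j) = e - g ⟨0, hn⟩ := by
  -- Extended by the end value `e`, the left end points form a telescoping sequence over `ℕ`.
  let F : ℕ → ℝ := fun m => if hm : m < n then g ⟨m, hm⟩ else e
  have h1 : ∀ j : Fin n, next j - g j = F (j.1 + 1) - F j.1 := fun j => by
    simp only [F, h j, j.2, dite_true]
  rw [Finset.sum_congr rfl fun j _ => h1 j, ← Finset.sum_range fun m => F (m + 1) - F m,
    Finset.sum_range_sub]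
  simp [F, hn]

namespace PrimaryMesh

variable (T : PrimaryMesh) {k : ℕ} (D : SymmetricDualPoints k)

theorem N_pos : 0 < T.N := by
  rcases Nat.eq_zero_or_pos T.N with h | h
  · exfalso
    have h1 : Fin.last T.N = 0 := Fin.ext (by simp [h])
    have h2 := T.x_last
    rw [h1, T.x_zero] at h2
    norm_num at h2
  · exact h

theorem x_nonneg (i : Fin (T.N + 1)) : 0 ≤ T.x i :=
  T.x_zero.symm.trans_le (T.strictMono.monotone (Fin.zero_le i))

theorem x_le_one (i : Fin (T.N + 1)) : T.x i ≤ 1 :=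
  (T.strictMono.monotone (Fin.le_last i)).trans_eq T.x_last

theorem x_lt (i : Fin T.N) : T.x i.castSucc < T.x i.succ :=
  T.strictMono i.castSucc_lt_succ

theorem len_pos (i : Fin T.N) : 0 < T.len i := sub_pos.2 (T.x_lt i)

theorem len_le_meshSize (i : Fin T.N) : T.len i ≤ T.meshSize :=
  le_ciSup (f := T.len) (finite_range _).bddAbove i

theorem x_succ_eq (i : Fin T.N) : T.x i.succ = T.x i.castSucc + T.len i := by
  simp [len]

theorem meshSize_pos : 0 < T.meshSize :=
  (T.len_pos ⟨0, T.N_pos⟩).trans_le (T.len_le_meshSize _)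

theorem sum_succ_sub (Φ : ℝ → ℝ) :
    ∑ i : Fin T.N, (Φ (T.x i.succ) - Φ (T.x i.castSucc)) = Φ 1 - Φ 0 := by
  have h := sum_next_sub T.N_pos (fun i => Φ (T.x i.castSucc)) (fun i => Φ (T.x i.succ)) (Φ 1)
    fun j => by
      split_ifs with hj
      · rfl
      · have : j.succ = Fin.last T.N := Fin.ext (by simp; omega)
        rw [this, T.x_last]
  have h0 : T.x (⟨0, T.N_pos⟩ : Fin T.N).castSucc = 0 := T.x_zero
  rw [h, h0]

theorem sum_len : ∑ i, T.len i = 1 := by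
  simpa [len] using T.sum_succ_sub id

theorem exists_mem_Ioo {y : ℝ} (h0 : 0 < y) (h1 : y < 1) (hy : y ∉ range T.x) :
    ∃ i : Fin T.N, y ∈ Ioo (T.x i.castSucc) (T.x i.succ) := by
  -- Induction on the first mesh point to the right of `y`.
  have key : ∀ m : Fin (T.N + 1), y < T.x m →
      ∃ i : Fin T.N, y ∈ Ioo (T.x i.castSucc) (T.x i.succ) := by
    intro m
    induction m using Fin.induction with
    | zero => intro h; rw [T.x_zero] at h; exact absurd h h0.not_gt
    | succ i ih =>
      intro h
      rcases lt_trichotomy y (T.x i.castSucc) with h' | h' | h'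
      · exact ih h'
      · exact absurd ⟨_, h'.symm⟩ hy
      · exact ⟨i, h', h⟩
  exact key (Fin.last _) (by rwa [T.x_last])

theorem dualPt_mem_Ioo (i : Fin T.N) (j : Fin k) :
    T.dualPt D i j ∈ Ioo (T.x i.castSucc) (T.x i.succ) :=
  SymmetricDualPoints.pt_mem_Ioo (T.x_lt i) j

theorem dualPt_mem_Icc (i : Fin T.N) (j : Fin k) : T.dualPt D i j ∈ Icc (0 : ℝ) 1 :=
  ⟨(T.x_nonneg _).trans (T.dualPt_mem_Ioo D i j).1.le,
    (T.dualPt_mem_Ioo D i j).2.le.trans (T.x_le_one _)⟩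

/-- A control volume reaches at most into the next element. -/
theorem dualPtNext_bounds (i : Fin T.N) (j : Fin k) :
    T.dualPt D i j ≤ T.dualPtNext D i j ∧ T.dualPtNext D i j ≤ 1 ∧
      T.dualPtNext D i j ≤ T.x i.castSucc + 2 * T.meshSize := by
  have h1 := T.dualPt_mem_Ioo D i j
  have h2 := T.len_le_meshSize i
  have h3 := T.meshSize_pos
  have h4 := T.x_succ_eq i
  unfold dualPtNext
  split_ifs with hj hi
  · have h5 := T.dualPt_mem_Ioo D i ⟨j.1 + 1, hj⟩
    have h6 : D.G j ≤ D.G ⟨j.1 + 1, hj⟩ := D.strictMono.monotone (Fin.le_def.2 (Nat.le_succ _))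
    have h7 := mul_le_mul_of_nonneg_left h6 (T.len_pos i).le
    refine ⟨?_, h5.2.le.trans (T.x_le_one _), by linarith [h5.2]⟩
    unfold dualPt; linarith
  · have h5 := T.dualPt_mem_Ioo D ⟨i.1 + 1, hi⟩ ⟨0, Nat.lt_of_le_of_lt (Nat.zero_le _) j.2⟩
    have h6 : T.x (⟨i.1 + 1, hi⟩ : Fin T.N).castSucc = T.x i.succ := rfl
    have h7 := T.x_succ_eq ⟨i.1 + 1, hi⟩
    have h8 := T.len_le_meshSize ⟨i.1 + 1, hi⟩
    rw [h6] at h5 h7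
    exact ⟨h1.2.le.trans h5.1.le, h5.2.le.trans (T.x_le_one _), by linarith [h5.2]⟩
  · have h5 : i.succ = Fin.last T.N := Fin.ext (by simp; omega)
    rw [h5, T.x_last] at h4
    exact ⟨h1.2.le.trans (T.x_le_one _), le_rfl, by linarith⟩

/-- The control volumes tile `[g_{1,1}, 1]`. -/
theorem sum_dualPtNext_sub (hk : 0 < k) (Φ : ℝ → ℝ) :
    ∑ i, ∑ j, (Φ (T.dualPtNext D i j) - Φ (T.dualPt D i j)) =
      Φ 1 - Φ (T.dualPt D ⟨0, T.N_pos⟩ ⟨0, hk⟩) := by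
  let nxt : Fin T.N → ℝ := fun i =>
    if hi : i.1 + 1 < T.N then Φ (T.dualPt D ⟨i.1 + 1, hi⟩ ⟨0, hk⟩) else Φ 1
  have h1 : ∀ i, ∑ j, (Φ (T.dualPtNext D i j) - Φ (T.dualPt D i j)) =
      nxt i - Φ (T.dualPt D i ⟨0, hk⟩) := fun i => by
    refine sum_next_sub hk (fun j => Φ (T.dualPt D i j)) _ (nxt i) fun j => ?_
    simp only [dualPtNext, nxt]
    split_ifs <;> rfl
  rw [Finset.sum_congr rfl fun i _ => h1 i]
  exact sum_next_sub T.N_pos (fun i => Φ (T.dualPt D i ⟨0, hk⟩)) nxt (Φ 1) fun i => rfl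

variable {T D}

theorem intervalIntegrable_of_mem {F : ℝ → ℝ} (hF : IntervalIntegrable F volume 0 1) {a b : ℝ}
    (ha : a ∈ Icc (0 : ℝ) 1) (hb : b ∈ Icc (0 : ℝ) 1) : IntervalIntegrable F volume a b :=
  hF.mono_set (by
    rw [uIcc_of_le zero_le_one]
    exact uIcc_subset_Icc ha hb)

theorem dualPtNext_mem_Icc (i : Fin T.N) (j : Fin k) : T.dualPtNext D i j ∈ Icc (0 : ℝ) 1 :=
  ⟨(T.dualPt_mem_Icc D i j).1.trans (T.dualPtNext_bounds D i j).1, (T.dualPtNext_bounds D i j).2.1⟩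

theorem sum_integral_dual (hk : 0 < k) {F : ℝ → ℝ} (hF : IntervalIntegrable F volume 0 1) :
    (∫ x in (0 : ℝ)..(T.dualPt D ⟨0, T.N_pos⟩ ⟨0, hk⟩), F x) +
      ∑ i, ∑ j, ∫ x in (T.dualPt D i j)..(T.dualPtNext D i j), F x = ∫ x in (0 : ℝ)..1, F x := by
  have h0 : (0 : ℝ) ∈ Icc (0 : ℝ) 1 := ⟨le_rfl, zero_le_one⟩
  have h1 : ∀ i j, ∫ x in (T.dualPt D i j)..(T.dualPtNext D i j), F x =
      (∫ x in (0 : ℝ)..(T.dualPtNext D i j), F x) - ∫ x in (0 : ℝ)..(T.dualPt D i j), F x :=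
    fun i j => (intervalIntegral.integral_interval_sub_left
      (intervalIntegrable_of_mem hF h0 (dualPtNext_mem_Icc i j))
      (intervalIntegrable_of_mem hF h0 (T.dualPt_mem_Icc D i j))).symm
  simp only [h1]
  rw [T.sum_dualPtNext_sub D hk fun y => ∫ x in (0 : ℝ)..y, F x]
  ring

theorem abs_integral_mul_le {g F : ℝ → ℝ} {η a b : ℝ} (hab : a ≤ b)
    (hF : IntervalIntegrable F volume a b) (hg : ∀ x ∈ Icc a b, |g x| ≤ η) :
    |∫ x in a..b, g x * F x| ≤ η * ∫ x in a..b, |F x| := by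
  rw [← intervalIntegral.integral_const_mul, ← Real.norm_eq_abs]
  refine intervalIntegral.norm_integral_le_of_norm_le hab ?_ (hF.abs.const_mul _)
  refine Filter.Eventually.of_forall fun x hx => ?_
  rw [norm_mul]
  exact mul_le_mul_of_nonneg_right (hg x (Ioc_subset_Icc_self hx)) (abs_nonneg _)

/-- Replacing the piecewise constant function with values `v i j` by a function `w` to which it is
uniformly close. -/
theorem abs_sum_mul_integral_sub_le (hk : 0 < k) {F w : ℝ → ℝ} {η : ℝ} {v : Fin T.N → Fin k → ℝ}
    (hF : IntervalIntegrable F volume 0 1) (hw : Continuous w)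
    (hv : ∀ i j, ∀ x ∈ Icc (T.dualPt D i j) (T.dualPtNext D i j), |v i j - w x| ≤ η)
    (hw0 : ∀ x ∈ Icc (0 : ℝ) (T.dualPt D ⟨0, T.N_pos⟩ ⟨0, hk⟩), |w x| ≤ η) :
    |(∑ i, ∑ j, v i j * ∫ x in (T.dualPt D i j)..(T.dualPtNext D i j), F x) -
      ∫ x in (0 : ℝ)..1, w x * F x| ≤ η * ∫ x in (0 : ℝ)..1, |F x| := by
  have hFw : IntervalIntegrable (fun x => w x * F x) volume 0 1 :=
    hF.continuousOn_mul hw.continuousOn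
  have hmem : ∀ i j, IntervalIntegrable F volume (T.dualPt D i j) (T.dualPtNext D i j) := fun i j =>
    intervalIntegrable_of_mem hF (T.dualPt_mem_Icc D i j) (dualPtNext_mem_Icc i j)
  have hmemw : ∀ i j, IntervalIntegrable (fun x => w x * F x) volume
      (T.dualPt D i j) (T.dualPtNext D i j) := fun i j =>
    intervalIntegrable_of_mem hFw (T.dualPt_mem_Icc D i j) (dualPtNext_mem_Icc i j)
  have hg0 := T.dualPt_mem_Icc D ⟨0, T.N_pos⟩ ⟨0, hk⟩
  have h0 : (0 : ℝ) ∈ Icc (0 : ℝ) 1 := ⟨le_rfl, zero_le_one⟩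
  have h1 : (∑ i, ∑ j, v i j * ∫ x in (T.dualPt D i j)..(T.dualPtNext D i j), F x) -
      ∫ x in (0 : ℝ)..1, w x * F x =
      (∑ i, ∑ j, ∫ x in (T.dualPt D i j)..(T.dualPtNext D i j), (v i j - w x) * F x) -
        ∫ x in (0 : ℝ)..(T.dualPt D ⟨0, T.N_pos⟩ ⟨0, hk⟩), w x * F x := by
    rw [← sum_integral_dual (T := T) (D := D) hk hFw]
    have h2 : ∀ i j, ∫ x in (T.dualPt D i j)..(T.dualPtNext D i j), (v i j - w x) * F x =
        v i j * (∫ x in (T.dualPt D i j)..(T.dualPtNext D i j), F x) -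
          ∫ x in (T.dualPt D i j)..(T.dualPtNext D i j), w x * F x := fun i j => by
      simp only [sub_mul]
      rw [intervalIntegral.integral_sub ((hmem i j).const_mul _) (hmemw i j),
        intervalIntegral.integral_const_mul]
    simp only [h2, Finset.sum_sub_distrib]
    ring
  rw [h1, ← sum_integral_dual (T := T) (D := D) hk hF.abs, mul_add, Finset.mul_sum]
  simp only [Finset.mul_sum]
  refine (abs_sub _ _).trans ?_
  rw [add_comm]
  refine add_le_add (abs_integral_mul_le hg0.1 (intervalIntegrable_of_mem hF h0 hg0) hw0)
    ((Finset.abs_sum_le_sum_abs _ _).trans (Finset.sum_le_sum fun i _ =>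
      (Finset.abs_sum_le_sum_abs _ _).trans (Finset.sum_le_sum fun j _ => ?_)))
  exact abs_integral_mul_le (T.dualPtNext_bounds D i j).1 (hmem i j) (hv i j)

theorem integral_mul_testFun {f : ℝ → ℝ} (hf : IntervalIntegrable f volume 0 1)
    (v : Fin T.N → Fin k → ℝ) :
    ∫ x in (0 : ℝ)..1, f x * T.testFun D v x =
      ∑ i, ∑ j, v i j * ∫ x in (T.dualPt D i j)..(T.dualPtNext D i j), f x := by
  have hind : ∀ i j x, f x * (v i j *
      (Icc (T.dualPt D i j) (T.dualPtNext D i j)).indicator (fun _ => (1 : ℝ)) x) =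
      v i j * (Icc (T.dualPt D i j) (T.dualPtNext D i j)).indicator f x := fun i j x => by
    by_cases hx : x ∈ Icc (T.dualPt D i j) (T.dualPtNext D i j)
    · simp [hx, mul_comm]
    · simp [hx]
  have hint : ∀ i j, IntervalIntegrable (fun x => v i j *
      (Icc (T.dualPt D i j) (T.dualPtNext D i j)).indicator f x) volume 0 1 := fun i j => by
    refine IntervalIntegrable.const_mul ?_ _
    rw [intervalIntegrable_iff_integrableOn_Ioc_of_le zero_le_one] at hf ⊢
    exact hf.indicator measurableSet_Icc
  have hsum : ∀ i, IntervalIntegrable (fun x => ∑ j, v i j *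
      (Icc (T.dualPt D i j) (T.dualPtNext D i j)).indicator f x) volume 0 1 := fun i => by
    have h := IntervalIntegrable.sum Finset.univ fun j _ => hint i j
    rwa [Finset.sum_fn] at h
  simp only [testFun, Finset.mul_sum, hind]
  rw [intervalIntegral.integral_finsetSum fun i _ => hsum i]
  refine Finset.sum_congr rfl fun i _ => ?_
  rw [intervalIntegral.integral_finsetSum fun j _ => hint i j]
  refine Finset.sum_congr rfl fun j _ => ?_
  rw [intervalIntegral.integral_const_mul]
  congr 1
  have h1 := T.dualPt_mem_Ioo D i j
  have h2 := T.dualPtNext_bounds D i j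
  have hsub : Icc (T.dualPt D i j) (T.dualPtNext D i j) ⊆ Ioc (0 : ℝ) 1 := fun x hx =>
    ⟨((T.x_nonneg _).trans_lt h1.1).trans_le hx.1, hx.2.trans h2.2.1⟩
  rw [intervalIntegral.integral_of_le zero_le_one, intervalIntegral.integral_of_le h2.1,
    integral_indicator measurableSet_Icc, Measure.restrict_restrict measurableSet_Icc,
    inter_eq_left.2 hsub, integral_Icc_eq_integral_Ioc]

/-! ### The trial space -/

variable {w : ℝ → ℝ}

/-- On an element the derivative of a trial function is a polynomial of degree less than `k`. -/
theorem exists_deriv_poly (hk : 0 < k) (hw : w ∈ T.trialSpace k) (i : Fin T.N) :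
    ∃ R : Polynomial ℝ, R.degree < k ∧
      ∀ x ∈ Ioo (T.x i.castSucc) (T.x i.succ), HasDerivAt w (R.eval x) x := by
  obtain ⟨P, hP, hPe⟩ := hw.2.2 i
  refine ⟨Polynomial.derivative P, ?_, fun x hx => ?_⟩
  · refine Polynomial.degree_le_natDegree.trans_lt (Nat.cast_lt.2 ?_)
    have := Polynomial.natDegree_derivative_le P
    omega
  · refine (P.hasDerivAt x).congr_of_eventuallyEq ?_
    filter_upwards [Icc_mem_nhds hx.1 hx.2] with y hy using hPe y hy

theorem piecewiseC1_of_mem (hk : 0 < k) (hw : w ∈ T.trialSpace k) : PiecewiseC1 w := by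
  choose R hR hRd using exists_deriv_poly hk hw
  have hb : ∀ i, ∃ B, ∀ x ∈ Icc (0 : ℝ) 1, |(R i).eval x| ≤ B := fun i => by
    obtain ⟨B, hB⟩ := isCompact_Icc.exists_bound_of_continuousOn (s := Icc (0 : ℝ) 1)
      (f := fun t => (R i).eval t) (Polynomial.continuous _).continuousOn
    exact ⟨B, hB⟩
  choose B hB using hb
  refine ⟨hw.1, hw.2.1, range T.x, ∑ i, |B i|, finite_range _, fun y hy => ?_⟩
  have hzero : (∃ U ∈ nhds y, ∀ z ∈ U, w z = 0) → DifferentiableAt ℝ w y ∧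
      ContinuousAt (deriv w) y ∧ |deriv w y| ≤ ∑ i, |B i| := by
    rintro ⟨U, hU, hU0⟩
    have he : w =ᶠ[nhds y] fun _ => 0 := Filter.eventually_of_mem hU hU0
    refine ⟨(differentiableAt_const _).congr_of_eventuallyEq he, ?_, ?_⟩
    · exact (continuousAt_const (y := (0 : ℝ))).congr (by simpa using he.deriv.symm)
    · rw [he.deriv_eq, deriv_const, abs_zero]
      exact Finset.sum_nonneg fun _ _ => abs_nonneg _
  have hy0 : y ≠ 0 := fun h => hy ⟨0, by rw [T.x_zero, h]⟩
  have hy1 : y ≠ 1 := fun h => hy ⟨Fin.last _, by rw [T.x_last, h]⟩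
  rcases lt_or_gt_of_ne hy0 with h0 | h0
  · exact hzero ⟨_, Iio_mem_nhds h0, fun z hz => hw.2.1 z fun h => (h.1.trans hz).false⟩
  rcases lt_or_gt_of_ne hy1 with h1 | h1
  · obtain ⟨i, hi⟩ := T.exists_mem_Ioo h0 h1 hy
    have hd := hRd i y hi
    refine ⟨hd.differentiableAt, ?_, ?_⟩
    · refine (Polynomial.continuous (R i)).continuousAt.congr ?_
      filter_upwards [Ioo_mem_nhds hi.1 hi.2] with z hz using (hRd i z hz).deriv.symm
    · rw [hd.deriv]
      refine ((hB i y ⟨h0.le, h1.le⟩).trans (le_abs_self _)).trans ?_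
      exact Finset.single_le_sum (f := fun i => |B i|) (fun _ _ => abs_nonneg _)
        (Finset.mem_univ i)
  · exact hzero ⟨_, Ioi_mem_nhds h1, fun z hz => hw.2.1 z fun h => (h.2.trans hz).false⟩

end PrimaryMesh

/-! ### The test function attached to a trial function -/

theorem sq_sum_abs_le {k : ℕ} (Y : Fin k → ℝ) : (∑ j, |Y j|) ^ 2 ≤ k * ∑ j, Y j ^ 2 := by
  simpa using sq_sum_le_card_mul_sum_sq (s := Finset.univ) (f := fun j => |Y j|)

/-- The arithmetic mean. -/
def mean {k : ℕ} (W : Fin k → ℝ) : ℝ := (∑ j, W j) / k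

section Algebra

variable {k : ℕ}

theorem sum_eq_mul_mean (hk : 0 < k) (W : Fin k → ℝ) : ∑ j, W j = k * mean W := by
  unfold mean
  field_simp

theorem sum_sub_mean (hk : 0 < k) (W : Fin k → ℝ) : ∑ j, (W j - mean W) = 0 := by
  rw [Finset.sum_sub_distrib, sum_eq_mul_mean hk]
  simp

theorem sum_sq_eq (hk : 0 < k) (W : Fin k → ℝ) :
    ∑ j, W j ^ 2 = k * mean W ^ 2 + ∑ j, (W j - mean W) ^ 2 := by
  have h : ∀ j, W j ^ 2 = (W j - mean W) ^ 2 + (2 * mean W) * (W j - mean W) + mean W ^ 2 :=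
    fun j => by ring
  rw [Finset.sum_congr rfl fun j _ => h j, Finset.sum_add_distrib, Finset.sum_add_distrib,
    ← Finset.mul_sum, sum_sub_mean hk]
  simp
  ring

/-- The jumps `d / k + lam * h * (W j - mean W)`, of sum `d`, form a coercive linear function of the
nodal values `W`, provided `d - h * mean W` is controlled by the oscillation of `W`. -/
theorem coercive_jump (hk : 0 < k) (W : Fin k → ℝ) {h d L : ℝ} (hh : 0 < h)
    (hd : (d - h * mean W) ^ 2 ≤ h ^ 2 * L * ∑ j, (W j - mean W) ^ 2) :
    h / (2 * k) * ∑ j, W j ^ 2 ≤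
      ∑ j, (d / k + (L + 1) / 2 * h * (W j - mean W)) * W j := by
  have hk' : (1 : ℝ) ≤ k := by exact_mod_cast hk
  set m := mean W with hm
  set q := ∑ j, (W j - m) ^ 2 with hq
  have hq0 : 0 ≤ q := Finset.sum_nonneg fun _ _ => sq_nonneg _
  have h1 : ∑ j, (d / k + (L + 1) / 2 * h * (W j - m)) * W j = d * m + (L + 1) / 2 * h * q := by
    have : ∀ j, (d / k + (L + 1) / 2 * h * (W j - m)) * W j =
        d / k * W j + (L + 1) / 2 * h * (W j - m) ^ 2 + (L + 1) / 2 * h * m * (W j - m) :=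
      fun j => by ring
    rw [Finset.sum_congr rfl fun j _ => this j, Finset.sum_add_distrib, Finset.sum_add_distrib,
      ← Finset.mul_sum, ← Finset.mul_sum, ← Finset.mul_sum, sum_sub_mean hk, sum_eq_mul_mean hk,
      mul_zero, add_zero, ← hm, ← hq]
    field_simp
  rw [h1, sum_sq_eq hk, div_mul_eq_mul_div, div_le_iff₀ (by positivity)]
  -- Replacing `d` by `h * m` costs half of the term `h * m²`, and a multiple of `q`.
  have h2 : -(h / 2 * m ^ 2) - h / 2 * L * q ≤ (d - h * m) * m := by
    have h3 : 0 ≤ (h * m + (d - h * m)) ^ 2 := sq_nonneg _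
    have h4 : h * (-(h / 2 * m ^ 2) - h / 2 * L * q) ≤ h * ((d - h * m) * m) := by nlinarith
    exact le_of_mul_le_mul_left h4 hh
  have h5 : h / 2 * m ^ 2 + h / 2 * q ≤ d * m + (L + 1) / 2 * h * q := by linarith
  have h6 : h * q ≤ h * q * k := le_mul_of_one_le_right (mul_nonneg hh.le hq0) hk'
  nlinarith [mul_le_mul_of_nonneg_right h5 (by positivity : (0 : ℝ) ≤ 2 * k)]

/-- The constant in the bound `sum_sq_jump_le` of the jumps by the nodal values; `L` is the one
in the hypothesis on `d - h * mean W`. -/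
def jumpConst (L : ℝ) : ℝ := 4 + 4 * L + 2 * ((L + 1) / 2) ^ 2

theorem sum_sq_jump_le (hk : 0 < k) (W : Fin k → ℝ) {h d L : ℝ} (hL : 0 ≤ L)
    (hd : (d - h * mean W) ^ 2 ≤ h ^ 2 * L * ∑ j, (W j - mean W) ^ 2) :
    ∑ j, (d / k + (L + 1) / 2 * h * (W j - mean W)) ^ 2 ≤
      h ^ 2 * jumpConst L * ∑ j, W j ^ 2 := by
  have hk' : (1 : ℝ) ≤ k := by exact_mod_cast hk
  rw [sum_sq_eq hk W]
  set m := mean W with hm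
  set q := ∑ j, (W j - m) ^ 2 with hq
  have hq0 : 0 ≤ q := Finset.sum_nonneg fun _ _ => sq_nonneg _
  have h1 : ∑ j, (d / k + (L + 1) / 2 * h * (W j - m)) ^ 2 =
      d ^ 2 / k + ((L + 1) / 2 * h) ^ 2 * q := by
    have : ∀ j, (d / k + (L + 1) / 2 * h * (W j - m)) ^ 2 =
        (d / k) ^ 2 + ((L + 1) / 2 * h) ^ 2 * (W j - m) ^ 2 +
          2 * (d / k) * ((L + 1) / 2 * h) * (W j - m) := fun j => by ring
    rw [Finset.sum_congr rfl fun j _ => this j, Finset.sum_add_distrib, Finset.sum_add_distrib,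
      ← Finset.mul_sum, ← Finset.mul_sum, sum_sub_mean hk]
    rw [← hq, Finset.sum_const, Finset.card_univ, Fintype.card_fin, nsmul_eq_mul, mul_zero,
      add_zero]
    field_simp
  have h2 : d ^ 2 / k ≤ d ^ 2 := div_le_self (sq_nonneg _) hk'
  have h3 : d ^ 2 ≤ 2 * (h ^ 2 * m ^ 2) + 2 * (h ^ 2 * L * q) := by
    nlinarith [sq_nonneg (h * m - (d - h * m))]
  have h4 : m ^ 2 ≤ k * m ^ 2 := le_mul_of_one_le_left (sq_nonneg _) hk'
  have h5 : h ^ 2 * m ^ 2 ≤ h ^ 2 * (k * m ^ 2) := mul_le_mul_of_nonneg_left h4 (sq_nonneg _)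
  have h6 : 0 ≤ h ^ 2 * q := mul_nonneg (sq_nonneg _) hq0
  have h7 : 0 ≤ h ^ 2 * (k * m ^ 2) := by positivity
  have h8 := mul_nonneg hL h7
  have h9 : 0 ≤ ((L + 1) / 2) ^ 2 * (h ^ 2 * (k * m ^ 2)) := mul_nonneg (sq_nonneg _) h7
  have h10 : 0 ≤ ((L + 1) / 2) ^ 2 * (h ^ 2 * q) := mul_nonneg (sq_nonneg _) h6
  have h11 := mul_nonneg hL h6
  rw [h1]
  unfold jumpConst
  nlinarith

/-- `coercive_jump` with a weight that is nearly constant. -/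
theorem coercive_jump_weighted (hk : 0 < k) (W : Fin k → ℝ) {h d L : ℝ} (hh : 0 < h) (hL : 0 ≤ L)
    (hd : (d - h * mean W) ^ 2 ≤ h ^ 2 * L * ∑ j, (W j - mean W) ^ 2) {p₀ P : ℝ} {p : Fin k → ℝ}
    (hp₀ : 0 < p₀) (hP : p₀ ≤ P) (hp : ∀ j, |p j - P| ≤ p₀ / (2 * k * (jumpConst L + 1))) :
    p₀ * h / (4 * k) * ∑ j, W j ^ 2 ≤
      ∑ j, (d / k + (L + 1) / 2 * h * (W j - mean W)) * p j * W j := by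
  have hk' : (0 : ℝ) < k := by exact_mod_cast hk
  have h1 := coercive_jump hk W hh hd
  have h2 := sum_sq_jump_le hk W hL hd
  have hC : 0 < jumpConst L + 1 := by unfold jumpConst; positivity
  set ε := p₀ / (2 * k * (jumpConst L + 1)) with hε
  have hε0 : 0 < ε := by positivity
  set S := ∑ j, W j ^ 2 with hS
  have hS0 : 0 ≤ S := Finset.sum_nonneg fun _ _ => sq_nonneg _
  set J : Fin k → ℝ := fun j => d / k + (L + 1) / 2 * h * (W j - mean W) with hJ
  have h3 : ∀ j, P * (J j * W j) - ε * (h⁻¹ / 2 * J j ^ 2 + h / 2 * W j ^ 2) ≤ J j * p j * W j := by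
    intro j
    have h4 : |(p j - P) * (J j * W j)| ≤ ε * (h⁻¹ / 2 * J j ^ 2 + h / 2 * W j ^ 2) := by
      rw [abs_mul]
      refine mul_le_mul (hp j) ?_ (abs_nonneg _) hε0.le
      have h5 : h⁻¹ / 2 * J j ^ 2 + h / 2 * W j ^ 2 =
          (J j ^ 2 + (h * W j) ^ 2) / (2 * h) := by field_simp
      rw [h5, le_div_iff₀ (by positivity), abs_mul]
      nlinarith [sq_nonneg (|J j| - h * |W j|), sq_abs (J j), sq_abs (W j)]
    have := (abs_le.1 h4).1
    nlinarith
  refine le_trans ?_ (Finset.sum_le_sum fun j _ => h3 j)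
  rw [Finset.sum_sub_distrib, ← Finset.mul_sum, ← Finset.mul_sum, Finset.sum_add_distrib,
    ← Finset.mul_sum, ← Finset.mul_sum]
  have h6 : p₀ * (h / (2 * k) * S) ≤ P * ∑ j, J j * W j :=
    mul_le_mul hP h1 (by positivity) (hp₀.le.trans hP)
  have h7 : h⁻¹ / 2 * ∑ j, J j ^ 2 ≤ h / 2 * jumpConst L * S := by
    refine (mul_le_mul_of_nonneg_left h2 (by positivity)).trans_eq ?_
    field_simp
  have h8 : ε * (h⁻¹ / 2 * ∑ j, J j ^ 2 + h / 2 * ∑ j, W j ^ 2) ≤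
      ε * (h / 2 * (jumpConst L + 1) * S) :=
    mul_le_mul_of_nonneg_left (by rw [← hS]; linarith) hε0.le
  have h9 : ε * (h / 2 * (jumpConst L + 1) * S) = p₀ * h / (4 * k) * S := by
    rw [hε]; field_simp; ring
  have h10 : p₀ * (h / (2 * k) * S) = 2 * (p₀ * h / (4 * k) * S) := by field_simp; ring
  linarith

end Algebra

namespace PrimaryMesh

variable {T : PrimaryMesh} {k : ℕ} {D : SymmetricDualPoints k} {w : ℝ → ℝ} {Λ : ℝ}

variable (T D) in
/-- The values of `w'` at the dual points of an element. -/
def nodalDeriv (w : ℝ → ℝ) (i : Fin T.N) (j : Fin k) : ℝ := deriv w (T.dualPt D i j)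

variable (T) in
/-- The increment of `w` over an element. -/
def incr (w : ℝ → ℝ) (i : Fin T.N) : ℝ := w (T.x i.succ) - w (T.x i.castSucc)

variable (T) in
/-- The square of the `H¹` seminorm on an element. -/
def elementEnergy (w : ℝ → ℝ) (i : Fin T.N) : ℝ :=
  ∫ x in (T.x i.castSucc)..(T.x i.succ), deriv w x ^ 2

theorem element_bounds (hk : 0 < k) (hΛ0 : 0 < Λ) (hΛ : D.IsNodalBound Λ) (hw : w ∈ T.trialSpace k)
    (i : Fin T.N) :
    T.len i * ∑ j, T.nodalDeriv D w i j ^ 2 ≤ Λ * T.elementEnergy w i ∧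
    T.elementEnergy w i ≤ T.len i * (Λ ^ 2 * k * ∑ j, T.nodalDeriv D w i j ^ 2) ∧
    (T.incr w i - T.len i * mean (T.nodalDeriv D w i)) ^ 2 ≤
      T.len i ^ 2 * (Λ ^ 2 * k) *
        ∑ j, (T.nodalDeriv D w i j - mean (T.nodalDeriv D w i)) ^ 2 := by
  obtain ⟨R, hR, hRd⟩ := exists_deriv_poly hk hw i
  have hlt := T.x_lt i
  have hnode : ∀ j, T.nodalDeriv D w i j = R.eval (D.pt (T.x i.castSucc) (T.x i.succ) j) :=
    fun j => (hRd _ (T.dualPt_mem_Ioo D i j)).deriv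
  have hen : T.elementEnergy w i = ∫ x in (T.x i.castSucc)..(T.x i.succ), R.eval x ^ 2 :=
    intervalIntegral.integral_congr_Ioo_of_le hlt.le fun x hx => by
      simp only [(hRd x hx).deriv]
  obtain ⟨h1, h2⟩ := hΛ _ _ hlt R hR
  simp only [← hnode] at h1 h2
  refine ⟨by rw [hen]; exact h2, ?_, ?_⟩
  · rw [hen]
    have h3 : ∀ x ∈ Icc (T.x i.castSucc) (T.x i.succ),
        R.eval x ^ 2 ≤ Λ ^ 2 * k * ∑ j, T.nodalDeriv D w i j ^ 2 := fun x hx => by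
      rw [← sq_abs]
      refine (pow_le_pow_left₀ (abs_nonneg _) (h1 x hx) 2).trans ?_
      rw [mul_pow, mul_assoc]
      exact mul_le_mul_of_nonneg_left (sq_sum_abs_le _) (sq_nonneg _)
    have h4 := intervalIntegral.integral_mono_on (μ := volume) hlt.le
      (((Polynomial.continuous R).pow 2).intervalIntegrable _ _) intervalIntegrable_const h3
    rwa [intervalIntegral.integral_const, smul_eq_mul] at h4
  · set m := mean (T.nodalDeriv D w i) with hm
    -- The nodal estimate is applied to the oscillating part of the derivative.
    have hR' : (R - Polynomial.C m).degree < k := by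
      refine (Polynomial.degree_sub_le _ _).trans_lt (max_lt hR ?_)
      exact Polynomial.degree_C_le.trans_lt (by exact_mod_cast hk)
    have h3 := (hΛ _ _ hlt (R - Polynomial.C m) hR').1
    simp only [Polynomial.eval_sub, Polynomial.eval_C, ← hnode] at h3
    have hpw := piecewiseC1_of_mem hk hw
    have h4 : T.incr w i - T.len i * m =
        ∫ x in (T.x i.castSucc)..(T.x i.succ), (deriv w x - m) := by
      rw [intervalIntegral.integral_sub (hpw.intervalIntegrable_deriv _ _)
        intervalIntegrable_const, hpw.integral_deriv, intervalIntegral.integral_const, smul_eq_mul]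
      rfl
    have h5 : |T.incr w i - T.len i * m| ≤
        Λ * (∑ j, |T.nodalDeriv D w i j - m|) * T.len i := by
      have h6 : ∫ x in (T.x i.castSucc)..(T.x i.succ), (deriv w x - m) =
          ∫ x in (T.x i.castSucc)..(T.x i.succ), (R.eval x - m) :=
        intervalIntegral.integral_congr_Ioo_of_le hlt.le fun x hx => by
          simp only [(hRd x hx).deriv]
      rw [h4, h6, ← Real.norm_eq_abs]
      refine (intervalIntegral.norm_integral_le_of_norm_le_const fun x hx => ?_).trans_eq
        (by rw [abs_of_pos (sub_pos.2 hlt)]; rfl)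
      rw [uIoc_of_le hlt.le] at hx
      exact h3 x (Ioc_subset_Icc_self hx)
    rw [← sq_abs]
    refine (pow_le_pow_left₀ (abs_nonneg _) h5 2).trans ?_
    have h7 := mul_le_mul_of_nonneg_left (sq_sum_abs_le fun j => T.nodalDeriv D w i j - m)
      (by positivity : 0 ≤ T.len i ^ 2 * Λ ^ 2)
    linarith

theorem sum_elementEnergy (hw : PiecewiseC1 w) :
    ∑ i, T.elementEnergy w i = ∫ x in (0 : ℝ)..1, deriv w x ^ 2 := by
  have h1 : ∀ i, T.elementEnergy w i =
      (∫ x in (0 : ℝ)..(T.x i.succ), deriv w x ^ 2) -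
        ∫ x in (0 : ℝ)..(T.x i.castSucc), deriv w x ^ 2 := fun i =>
    (intervalIntegral.integral_interval_sub_left (hw.intervalIntegrable_deriv_sq _ _)
      (hw.intervalIntegrable_deriv_sq _ _)).symm
  rw [Finset.sum_congr rfl fun i _ => h1 i,
    T.sum_succ_sub fun y => ∫ x in (0 : ℝ)..y, deriv w x ^ 2]
  simp

theorem elementEnergy_nonneg (i : Fin T.N) : 0 ≤ T.elementEnergy w i :=
  intervalIntegral.integral_nonneg (T.x_lt i).le fun _ _ => sq_nonneg _

variable (T D) in
/-- The test function with values `w(x_i)` at the end of each element, whose jumps are the sum of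
an equal share of the increment of `w` over the element and of a multiple of the oscillation of
the values of `w'` at the dual points. -/
def testOfTrial (lam : ℝ) (w : ℝ → ℝ) (i : Fin T.N) (j : Fin k) : ℝ :=
  w (T.x i.castSucc) + ((j.1 + 1 : ℕ) : ℝ) / k * T.incr w i +
    lam * T.len i * ∑ l ∈ Finset.Iic j, (T.nodalDeriv D w i l - mean (T.nodalDeriv D w i))

theorem testOfTrial_last (hk : 0 < k) (lam : ℝ) (w : ℝ → ℝ) (i : Fin T.N) (j : Fin k)
    (hj : j.1 + 1 = k) : T.testOfTrial D lam w i j = w (T.x i.succ) := by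
  have h1 : Finset.Iic j = Finset.univ := by
    ext l
    simp only [Finset.mem_Iic, Fin.le_def, Finset.mem_univ, iff_true]
    omega
  have hk' : (k : ℝ) ≠ 0 := by positivity
  rw [testOfTrial, h1, sum_sub_mean hk, hj, div_self hk', incr]
  ring

theorem testOfTrial_mem (hk : 0 < k) (lam : ℝ) (hw : w ∈ T.trialSpace k) :
    T.testOfTrial D lam w ∈ T.testSpace k := by
  intro i j hi hj
  have h1 : i.succ = Fin.last T.N := Fin.ext (by simp; omega)
  rw [testOfTrial_last hk lam w i j hj, h1, T.x_last]
  exact hw.2.1 1 (by simp)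

theorem jump_testOfTrial (hk : 0 < k) (lam : ℝ) (hw : w ∈ T.trialSpace k) (i : Fin T.N)
    (j : Fin k) :
    jump (T.testOfTrial D lam w) i j = T.incr w i / k +
      lam * T.len i * (T.nodalDeriv D w i j - mean (T.nodalDeriv D w i)) := by
  have hk' : (k : ℝ) ≠ 0 := by positivity
  have hfirst : j.1 = 0 → T.testOfTrial D lam w i j = w (T.x i.castSucc) + T.incr w i / k +
      lam * T.len i * (T.nodalDeriv D w i j - mean (T.nodalDeriv D w i)) := fun hj => by
    have h1 : Finset.Iic j = {j} := by
      ext l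
      simp only [Finset.mem_Iic, Fin.le_def, Finset.mem_singleton, Fin.ext_iff]
      omega
    rw [testOfTrial, h1, Finset.sum_singleton, hj]
    push_cast
    ring
  unfold jump prevVal
  split_ifs with hj hi
  · set j' : Fin k := ⟨j.1 - 1, Nat.lt_of_le_of_lt (Nat.sub_le _ _) j.2⟩ with hj'
    have h1 : Finset.Iic j = insert j (Finset.Iic j') := by
      ext l
      simp only [Finset.mem_Iic, Fin.le_def, Finset.mem_insert, Fin.ext_iff, hj']
      omega
    have h2 : j ∉ Finset.Iic j' := by
      simp only [Finset.mem_Iic, Fin.le_def, hj']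
      omega
    have h3 : ((j.1 + 1 : ℕ) : ℝ) = ((j'.1 + 1 : ℕ) : ℝ) + 1 := by
      have : j.1 + 1 = j'.1 + 1 + 1 := by simp [hj']; omega
      rw [this, Nat.cast_succ (j'.1 + 1)]
    rw [testOfTrial, testOfTrial, h1, Finset.sum_insert h2, h3]
    ring
  · rw [hfirst (by omega), testOfTrial_last hk lam w _ _ (by simp; omega)]
    have h1 : (⟨i.1 - 1, Nat.lt_of_le_of_lt (Nat.sub_le _ _) i.2⟩ : Fin T.N).succ = i.castSucc :=
      Fin.ext (by simp; omega)
    rw [h1]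
    ring
  · have h1 : i.castSucc = 0 := Fin.ext (by simp; omega)
    rw [hfirst (by omega), h1, T.x_zero, hw.2.1 0 (by simp)]
    ring

end PrimaryMesh

/-! ### Stability of the test functions -/

/-- The `H¹` seminorm. -/
def seminorm (w : ℝ → ℝ) : ℝ := Real.sqrt (∫ x in (0 : ℝ)..1, deriv w x ^ 2)

theorem seminorm_nonneg (w : ℝ → ℝ) : 0 ≤ seminorm w := Real.sqrt_nonneg _

theorem seminorm_sq (w : ℝ → ℝ) : seminorm w ^ 2 = ∫ x in (0 : ℝ)..1, deriv w x ^ 2 :=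
  Real.sq_sqrt (intervalIntegral.integral_nonneg zero_le_one fun _ _ => sq_nonneg _)

theorem h1Norm_sq (w : ℝ → ℝ) :
    h1Norm w ^ 2 = (∫ x in (0 : ℝ)..1, w x ^ 2) + seminorm w ^ 2 := by
  rw [seminorm_sq]
  exact Real.sq_sqrt (add_nonneg
    (intervalIntegral.integral_nonneg zero_le_one fun _ _ => sq_nonneg _)
    (intervalIntegral.integral_nonneg zero_le_one fun _ _ => sq_nonneg _))

theorem h1Norm_nonneg (w : ℝ → ℝ) : 0 ≤ h1Norm w := Real.sqrt_nonneg _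

theorem seminorm_le_h1Norm (w : ℝ → ℝ) : seminorm w ≤ h1Norm w := by
  refine (le_abs_self _).trans (abs_le_of_sq_le_sq ?_ (h1Norm_nonneg w))
  rw [h1Norm_sq]
  exact le_add_of_nonneg_left
    (intervalIntegral.integral_nonneg zero_le_one fun _ _ => sq_nonneg _)

namespace PiecewiseC1

variable {w : ℝ → ℝ}

theorem abs_sub_le (hw : PiecewiseC1 w) {x y c : ℝ} (hx : 0 ≤ x) (hxy : x ≤ y) (hy : y ≤ 1)
    (hc : 0 ≤ c) (h : y - x ≤ c ^ 2) : |w y - w x| ≤ c * seminorm w := by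
  refine abs_le_of_sq_le_sq ?_ (mul_nonneg hc (seminorm_nonneg w))
  refine (hw.sq_sub_le hx hxy hy).trans ?_
  rw [mul_pow, seminorm_sq]
  exact mul_le_mul_of_nonneg_right h
    (intervalIntegral.integral_nonneg zero_le_one fun _ _ => sq_nonneg _)

theorem abs_le (hw : PiecewiseC1 w) {x : ℝ} (hx : 0 ≤ x) (hx1 : x ≤ 1) : |w x| ≤ seminorm w := by
  have h := hw.abs_sub_le le_rfl hx hx1 zero_le_one (by linarith)
  rwa [hw.zero_outside 0 (by simp), sub_zero, one_mul] at h

theorem integral_abs_deriv_le (hw : PiecewiseC1 w) :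
    ∫ x in (0 : ℝ)..1, |deriv w x| ≤ seminorm w := by
  refine (le_abs_self _).trans (abs_le_of_sq_le_sq ?_ (seminorm_nonneg w))
  have h := sq_integral_le zero_le_one (hw.intervalIntegrable_deriv 0 1).abs
    (by simpa only [sq_abs] using hw.intervalIntegrable_deriv_sq 0 1)
  simpa only [sq_abs, sub_zero, one_mul, ← seminorm_sq] using h

theorem intervalIntegrable_lower (hw : PiecewiseC1 w) {q r : ℝ → ℝ}
    (hq : MemLp q ⊤ (volume.restrict (Ioo (0 : ℝ) 1)))
    (hr : MemLp r ⊤ (volume.restrict (Ioo (0 : ℝ) 1))) :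
    IntervalIntegrable (fun x => q x * deriv w x + r x * w x) volume 0 1 := by
  obtain ⟨M, -, hM⟩ := hw.exists_ae_deriv_bound
  obtain ⟨B, -, hB⟩ := hw.exists_bound
  exact (integrable_mul_of_ae_bound hq (measurable_deriv w) (hM.mono fun x hx => hx.2.2)).add
    (integrable_mul_of_ae_bound hr hw.continuous.measurable (Filter.Eventually.of_forall hB))

theorem integral_abs_lower_le (hw : PiecewiseC1 w) {q r : ℝ → ℝ} {Q R : ℝ}
    (hQ : ∀ᵐ x ∂(volume.restrict (Ioc (0 : ℝ) 1)), |q x| ≤ Q)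
    (hR : ∀ᵐ x ∂(volume.restrict (Ioc (0 : ℝ) 1)), |r x| ≤ R) (hQ0 : 0 ≤ Q) (hR0 : 0 ≤ R) :
    ∫ x in (0 : ℝ)..1, |q x * deriv w x + r x * w x| ≤ (Q + R) * seminorm w := by
  have hI : IntervalIntegrable (fun x => Q * |deriv w x| + R * seminorm w) volume 0 1 :=
    ((hw.intervalIntegrable_deriv 0 1).abs.const_mul Q).add intervalIntegrable_const
  have h1 : ∫ x in (0 : ℝ)..1, |q x * deriv w x + r x * w x| ≤
      ∫ x in (0 : ℝ)..1, (Q * |deriv w x| + R * seminorm w) := by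
    rw [intervalIntegral.integral_of_le zero_le_one, intervalIntegral.integral_of_le zero_le_one]
    refine integral_mono_of_nonneg (Filter.Eventually.of_forall fun _ => abs_nonneg _)
      ((intervalIntegrable_iff_integrableOn_Ioc_of_le zero_le_one).1 hI) ?_
    filter_upwards [hQ, hR, ae_restrict_mem measurableSet_Ioc] with x h1 h2 hx
    refine (abs_add_le _ _).trans (add_le_add ?_ ?_)
    · rw [abs_mul]
      exact mul_le_mul_of_nonneg_right h1 (abs_nonneg _)
    · rw [abs_mul]
      exact mul_le_mul h2 (hw.abs_le hx.1.le hx.2) (abs_nonneg _) hR0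
  refine h1.trans ?_
  rw [intervalIntegral.integral_add ((hw.intervalIntegrable_deriv 0 1).abs.const_mul Q)
    intervalIntegrable_const, intervalIntegral.integral_const_mul, intervalIntegral.integral_const]
  have := mul_le_mul_of_nonneg_left hw.integral_abs_deriv_le hQ0
  simp only [sub_zero, one_smul]
  linarith

end PiecewiseC1

namespace PrimaryMesh

variable {T : PrimaryMesh} {k : ℕ} {D : SymmetricDualPoints k} {w : ℝ → ℝ} {Λ : ℝ}

/-- The constant in `abs_testOfTrial_sub_le`. -/
def closeConst (k : ℕ) (Λ lam : ℝ) : ℝ := 3 + lam * Real.sqrt (k * Λ)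

theorem closeConst_pos (k : ℕ) (Λ : ℝ) {lam : ℝ} (hlam : 0 ≤ lam) : 0 < closeConst k Λ lam := by
  unfold closeConst; positivity

theorem elementEnergy_le (hw : PiecewiseC1 w) (i : Fin T.N) :
    T.elementEnergy w i ≤ seminorm w ^ 2 := by
  rw [seminorm_sq, ← sum_elementEnergy (T := T) hw]
  exact Finset.single_le_sum (f := T.elementEnergy w) (fun i _ => elementEnergy_nonneg i)
    (Finset.mem_univ i)

/-- On its control volume the test function is close to the trial function in the maximum norm. -/
theorem abs_testOfTrial_sub_le (hk : 0 < k) (hΛ0 : 0 < Λ) (hΛ : D.IsNodalBound Λ) {lam : ℝ}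
    (hlam : 0 ≤ lam) (hw : w ∈ T.trialSpace k) (i : Fin T.N) (j : Fin k) {x : ℝ}
    (hx : T.x i.castSucc ≤ x) (hx1 : x ≤ 1) (hx2 : x ≤ T.x i.castSucc + 2 * T.meshSize) :
    |T.testOfTrial D lam w i j - w x| ≤
      closeConst k Λ lam * Real.sqrt T.meshSize * seminorm w := by
  have hpw := piecewiseC1_of_mem hk hw
  have hk' : (0 : ℝ) < k := by exact_mod_cast hk
  set s := Real.sqrt T.meshSize with hs
  have hs0 : 0 ≤ s := Real.sqrt_nonneg _
  have hs2 : s ^ 2 = T.meshSize := Real.sq_sqrt T.meshSize_pos.le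
  set A := seminorm w with hA
  have hA0 : 0 ≤ A := seminorm_nonneg w
  have hlen := T.len_pos i
  have hlenh := T.len_le_meshSize i
  have h1 : |w x - w (T.x i.castSucc)| ≤ 2 * s * A :=
    hpw.abs_sub_le (T.x_nonneg _) hx hx1 (by positivity) (by rw [mul_pow, hs2]; linarith)
  have h2 : |T.incr w i| ≤ s * A :=
    hpw.abs_sub_le (T.x_nonneg _) (T.x_lt i).le (T.x_le_one _) hs0 (by rw [hs2]; exact hlenh)
  have h3 : |((j.1 + 1 : ℕ) : ℝ) / k * T.incr w i| ≤ s * A := by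
    rw [abs_mul, abs_of_nonneg (by positivity)]
    refine (mul_le_of_le_one_left (abs_nonneg _) ?_).trans h2
    rw [div_le_one hk']
    exact_mod_cast j.2
  set Y : Fin k → ℝ := fun l => T.nodalDeriv D w i l - mean (T.nodalDeriv D w i) with hY
  have h4 : T.len i * ∑ l, |Y l| ≤ Real.sqrt (k * Λ) * s * A := by
    refine (le_abs_self _).trans (abs_le_of_sq_le_sq ?_ (by positivity))
    rw [mul_pow, mul_pow, mul_pow, Real.sq_sqrt (by positivity), hs2]
    have h5 : ∑ l, Y l ^ 2 ≤ ∑ l, T.nodalDeriv D w i l ^ 2 := by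
      rw [sum_sq_eq hk (T.nodalDeriv D w i)]
      exact le_add_of_nonneg_left (by positivity)
    have h6 := (element_bounds hk hΛ0 hΛ hw i).1
    have h7 := elementEnergy_le (T := T) hpw i
    have h8 : T.len i * ∑ l, Y l ^ 2 ≤ Λ * A ^ 2 :=
      (mul_le_mul_of_nonneg_left h5 hlen.le).trans
        (h6.trans (mul_le_mul_of_nonneg_left h7 hΛ0.le))
    calc T.len i ^ 2 * (∑ l, |Y l|) ^ 2 ≤ T.len i ^ 2 * (k * ∑ l, Y l ^ 2) :=
          mul_le_mul_of_nonneg_left (sq_sum_abs_le Y) (sq_nonneg _)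
      _ = T.len i * k * (T.len i * ∑ l, Y l ^ 2) := by ring
      _ ≤ T.meshSize * k * (Λ * A ^ 2) :=
          mul_le_mul (mul_le_mul_of_nonneg_right hlenh hk'.le) h8
            (mul_nonneg hlen.le (Finset.sum_nonneg fun _ _ => sq_nonneg _))
            (mul_nonneg T.meshSize_pos.le hk'.le)
      _ = k * Λ * T.meshSize * A ^ 2 := by ring
  have h9 : |lam * T.len i * ∑ l ∈ Finset.Iic j, Y l| ≤ lam * (Real.sqrt (k * Λ) * s * A) := by
    rw [abs_mul, abs_of_nonneg (by positivity), mul_assoc]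
    refine mul_le_mul_of_nonneg_left (le_trans ?_ h4) hlam
    refine mul_le_mul_of_nonneg_left ((Finset.abs_sum_le_sum_abs _ _).trans ?_) hlen.le
    exact Finset.sum_le_sum_of_subset_of_nonneg (Finset.subset_univ _) fun _ _ _ => abs_nonneg _
  have h10 : T.testOfTrial D lam w i j - w x = -(w x - w (T.x i.castSucc)) +
      ((j.1 + 1 : ℕ) : ℝ) / k * T.incr w i + lam * T.len i * ∑ l ∈ Finset.Iic j, Y l := by
    rw [testOfTrial]; ring
  rw [h10]
  refine (abs_add_three _ _ _).trans ?_
  rw [abs_neg]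
  unfold closeConst
  linarith

theorem abs_testOfTrial_le (hk : 0 < k) (hΛ0 : 0 < Λ) (hΛ : D.IsNodalBound Λ) {lam : ℝ}
    (hlam : 0 ≤ lam) (hw : w ∈ T.trialSpace k) (hh : T.meshSize ≤ 1) (i : Fin T.N) (j : Fin k) :
    |T.testOfTrial D lam w i j| ≤ (closeConst k Λ lam + 1) * seminorm w := by
  have hpw := piecewiseC1_of_mem hk hw
  have h1 := abs_testOfTrial_sub_le hk hΛ0 hΛ hlam hw i j le_rfl (T.x_le_one _)
    (by linarith [T.meshSize_pos])
  have h2 := hpw.abs_le (T.x_nonneg i.castSucc) (T.x_le_one i.castSucc)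
  have h3 : closeConst k Λ lam * Real.sqrt T.meshSize * seminorm w ≤
      closeConst k Λ lam * seminorm w :=
    mul_le_mul_of_nonneg_right (mul_le_of_le_one_right (closeConst_pos k Λ hlam).le
      (Real.sqrt_le_one.2 hh)) (seminorm_nonneg w)
  have h4 := abs_sub_abs_le_abs_sub (T.testOfTrial D lam w i j) (w (T.x i.castSucc))
  linarith

/-- The multiple of the oscillation of `w'` used in the test function: large enough for
`coercive_jump`, where `L = Λ ^ 2 * k` by `element_bounds`. -/
def oscConst (k : ℕ) (Λ : ℝ) : ℝ := (Λ ^ 2 * k + 1) / 2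

theorem oscConst_nonneg (k : ℕ) (Λ : ℝ) : 0 ≤ oscConst k Λ := by
  unfold oscConst; positivity

/-- The constant in `dualNorm_testOfTrial_le`. -/
def dualConst (k : ℕ) (Λ : ℝ) : ℝ :=
  Real.sqrt (jumpConst (Λ ^ 2 * k) * Λ + k * (closeConst k Λ (oscConst k Λ) + 1) ^ 2)

theorem sum_len_mul_le (hk : 0 < k) (hΛ0 : 0 < Λ) (hΛ : D.IsNodalBound Λ)
    (hw : w ∈ T.trialSpace k) :
    ∑ i, T.len i * ∑ j, T.nodalDeriv D w i j ^ 2 ≤ Λ * seminorm w ^ 2 := by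
  rw [seminorm_sq, ← sum_elementEnergy (T := T) (piecewiseC1_of_mem hk hw), Finset.mul_sum]
  exact Finset.sum_le_sum fun i _ => (element_bounds hk hΛ0 hΛ hw i).1

theorem seminorm_sq_le_sum (hk : 0 < k) (hΛ0 : 0 < Λ) (hΛ : D.IsNodalBound Λ)
    (hw : w ∈ T.trialSpace k) :
    seminorm w ^ 2 ≤ Λ ^ 2 * k * ∑ i, T.len i * ∑ j, T.nodalDeriv D w i j ^ 2 := by
  rw [seminorm_sq, ← sum_elementEnergy (T := T) (piecewiseC1_of_mem hk hw), Finset.mul_sum]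
  refine Finset.sum_le_sum fun i _ => (element_bounds hk hΛ0 hΛ hw i).2.1.trans_eq ?_
  ring

theorem dualNorm_testOfTrial_le (hk : 0 < k) (hΛ0 : 0 < Λ) (hΛ : D.IsNodalBound Λ)
    (hw : w ∈ T.trialSpace k) (hh : T.meshSize ≤ 1) :
    T.dualNorm (T.testOfTrial D (oscConst k Λ) w) ≤ dualConst k Λ * seminorm w := by
  have hC : 0 ≤ jumpConst (Λ ^ 2 * k) := by unfold jumpConst; positivity
  unfold dualNorm
  rw [Real.sqrt_le_iff]
  refine ⟨mul_nonneg (Real.sqrt_nonneg _) (seminorm_nonneg w), ?_⟩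
  rw [mul_pow, dualConst, Real.sq_sqrt (by positivity), add_mul]
  refine add_le_add ?_ ?_
  · rw [mul_assoc]
    refine le_trans ?_ (mul_le_mul_of_nonneg_left (sum_len_mul_le hk hΛ0 hΛ hw) hC)
    rw [Finset.mul_sum]
    refine Finset.sum_le_sum fun i _ => ?_
    rw [← Finset.mul_sum]
    simp only [jump_testOfTrial hk _ hw]
    have h1 := sum_sq_jump_le hk (T.nodalDeriv D w i) (by positivity)
      (element_bounds hk hΛ0 hΛ hw i).2.2
    have hlen := T.len_pos i
    refine (mul_le_mul_of_nonneg_left h1 (inv_pos.2 hlen).le).trans_eq ?_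
    field_simp
  · have h1 : ∀ i j, T.len i * T.testOfTrial D (oscConst k Λ) w i j ^ 2 ≤
        T.len i * ((closeConst k Λ (oscConst k Λ) + 1) * seminorm w) ^ 2 := fun i j => by
      refine mul_le_mul_of_nonneg_left ?_ (T.len_pos i).le
      rw [← sq_abs]
      exact pow_le_pow_left₀ (abs_nonneg _)
        (abs_testOfTrial_le hk hΛ0 hΛ (oscConst_nonneg k Λ) hw hh i j) 2
    refine (Finset.sum_le_sum fun i _ => Finset.sum_le_sum fun j _ => h1 i j).trans_eq ?_
    simp only [Finset.sum_const, Finset.card_univ, Fintype.card_fin, nsmul_eq_mul]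
    rw [← Finset.mul_sum, ← Finset.sum_mul, T.sum_len]
    ring

/-! ### Coercivity -/

theorem bilin_testOfTrial_ge (hk : 0 < k) (hΛ0 : 0 < Λ) (hΛ : D.IsNodalBound Λ)
    {p₀ γ : ℝ} (hp₀ : 0 < p₀) {p q r : ℝ → ℝ} (h : AdmissibleCoefficients p₀ γ p q r) {Q R : ℝ}
    (hQ : ∀ᵐ x ∂(volume.restrict (Ioc (0 : ℝ) 1)), |q x| ≤ Q)
    (hR : ∀ᵐ x ∂(volume.restrict (Ioc (0 : ℝ) 1)), |r x| ≤ R) (hQ0 : 0 ≤ Q) (hR0 : 0 ≤ R)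
    (hmod : ∀ x ∈ Icc (0 : ℝ) 1, ∀ y ∈ Icc (0 : ℝ) 1, |x - y| ≤ T.meshSize →
      |p x - p y| ≤ p₀ / (2 * k * (jumpConst (Λ ^ 2 * k) + 1)))
    (hw : w ∈ T.trialSpace k) :
    p₀ / (4 * k * (Λ ^ 2 * k)) * seminorm w ^ 2 + γ * (∫ x in (0 : ℝ)..1, w x ^ 2) -
      closeConst k Λ (oscConst k Λ) * (Q + R) * Real.sqrt T.meshSize * seminorm w ^ 2 ≤
      T.bilin D p q r w (T.testOfTrial D (oscConst k Λ) w) := by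
  have hpw := piecewiseC1_of_mem hk hw
  have hk' : (0 : ℝ) < k := by exact_mod_cast hk
  have hmain : p₀ / (4 * k * (Λ ^ 2 * k)) * seminorm w ^ 2 ≤
      ∑ i, ∑ j, jump (T.testOfTrial D (oscConst k Λ) w) i j * p (T.dualPt D i j) *
        deriv w (T.dualPt D i j) := by
    have h1 : ∀ i, p₀ * T.len i / (4 * k) * ∑ j, T.nodalDeriv D w i j ^ 2 ≤
        ∑ j, jump (T.testOfTrial D (oscConst k Λ) w) i j * p (T.dualPt D i j) *
          deriv w (T.dualPt D i j) := fun i => by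
      simp only [jump_testOfTrial hk _ hw]
      have hx := T.x_lt i
      have hxI : T.x i.castSucc ∈ Icc (0 : ℝ) 1 := ⟨T.x_nonneg _, T.x_le_one _⟩
      refine coercive_jump_weighted hk (T.nodalDeriv D w i) (T.len_pos i) (by positivity)
        (element_bounds hk hΛ0 hΛ hw i).2.2 hp₀ (h.le_p _ hxI)
        fun j => hmod _ (T.dualPt_mem_Icc D i j) _ hxI ?_
      have h2 := T.dualPt_mem_Ioo D i j
      rw [abs_of_nonneg (sub_nonneg.2 h2.1.le)]
      linarith [T.len_le_meshSize i, T.x_succ_eq i, h2.2]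
    refine le_trans ?_ (Finset.sum_le_sum fun i _ => h1 i)
    have h3 : ∑ i, p₀ * T.len i / (4 * k) * ∑ j, T.nodalDeriv D w i j ^ 2 =
        p₀ / (4 * k) * ∑ i, T.len i * ∑ j, T.nodalDeriv D w i j ^ 2 := by
      rw [Finset.mul_sum]
      exact Finset.sum_congr rfl fun i _ => by ring
    rw [h3]
    refine (mul_le_mul_of_nonneg_left (seminorm_sq_le_sum hk hΛ0 hΛ hw)
      (by positivity)).trans_eq ?_
    field_simp
  set η := closeConst k Λ (oscConst k Λ) * Real.sqrt T.meshSize * seminorm w with hη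
  have hη0 : 0 ≤ η := mul_nonneg (mul_nonneg (closeConst_pos k Λ (oscConst_nonneg k Λ)).le
    (Real.sqrt_nonneg _)) (seminorm_nonneg w)
  have hlow := abs_sum_mul_integral_sub_le (T := T) (D := D) hk (η := η)
    (v := T.testOfTrial D (oscConst k Λ) w) (hpw.intervalIntegrable_lower h.memLp_q h.memLp_r)
    hpw.continuous
    (fun i j x hx => abs_testOfTrial_sub_le hk hΛ0 hΛ (oscConst_nonneg k Λ) hw i j
      ((T.dualPt_mem_Ioo D i j).1.le.trans hx.1) (hx.2.trans (T.dualPtNext_bounds D i j).2.1)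
      (hx.2.trans (T.dualPtNext_bounds D i j).2.2))
    -- Left of the first dual point the test function is zero, and `w` is small.
    (fun x hx => by
      have h1 := T.dualPt_mem_Ioo D ⟨0, T.N_pos⟩ ⟨0, hk⟩
      have h2 : T.x (⟨0, T.N_pos⟩ : Fin T.N).castSucc = 0 := T.x_zero
      have h3 := T.x_succ_eq ⟨0, T.N_pos⟩
      have h4 := T.len_le_meshSize ⟨0, T.N_pos⟩
      have h5 := hpw.abs_sub_le le_rfl hx.1 (hx.2.trans (T.dualPt_mem_Icc D _ _).2)
        (Real.sqrt_nonneg T.meshSize)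
        (by rw [Real.sq_sqrt T.meshSize_pos.le]; linarith [h1.2, hx.2])
      rw [hpw.zero_outside 0 (by simp), sub_zero] at h5
      refine h5.trans (mul_le_mul_of_nonneg_right ?_ (seminorm_nonneg w))
      refine le_mul_of_one_le_left (Real.sqrt_nonneg _) ?_
      have := mul_nonneg (oscConst_nonneg k Λ) (Real.sqrt_nonneg (k * Λ))
      unfold closeConst
      linarith)
  have hF := mul_le_mul_of_nonneg_left (hpw.integral_abs_lower_le hQ hR hQ0 hR0) hη0
  have hen := h.energy_bound hpw
  have h1 := (abs_le.1 (hlow.trans hF)).1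
  have h2 : η * ((Q + R) * seminorm w) = closeConst k Λ (oscConst k Λ) * (Q + R) *
      Real.sqrt T.meshSize * seminorm w ^ 2 := by rw [hη]; ring
  unfold bilin
  linarith

end PrimaryMesh

/-- The inf-sup condition with an explicit test function, which is in addition bounded in the
maximum norm. -/
theorem exists_coercive_test {k : ℕ} (hk : 0 < k) (D : SymmetricDualPoints k) {p₀ γ : ℝ}
    (hp₀ : 0 < p₀) (hγ : 0 < γ) :
    ∃ c : ℝ, 0 < c ∧ ∃ K : ℝ, 0 < K ∧
      ∀ p q r : ℝ → ℝ, AdmissibleCoefficients p₀ γ p q r →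
        ∃ h₀ : ℝ, 0 < h₀ ∧ ∀ T : PrimaryMesh, T.meshSize < h₀ → ∀ w ∈ T.trialSpace k,
          ∃ v ∈ T.testSpace k, c * h1Norm w ^ 2 ≤ T.bilin D p q r w v ∧
            T.dualNorm v ≤ K * h1Norm w ∧ ∀ i j, |v i j| ≤ K * h1Norm w := by
  obtain ⟨Λ, hΛ0, hΛ⟩ := D.exists_isNodalBound
  have hk' : (0 : ℝ) < k := by exact_mod_cast hk
  set c₁ := p₀ / (4 * k * (Λ ^ 2 * k)) with hc₁
  have hc₁0 : 0 < c₁ := by positivity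
  set κ := PrimaryMesh.closeConst k Λ (PrimaryMesh.oscConst k Λ) with hκ
  have hκ0 : 0 < κ := PrimaryMesh.closeConst_pos k Λ (PrimaryMesh.oscConst_nonneg k Λ)
  have hd0 : 0 ≤ PrimaryMesh.dualConst k Λ := Real.sqrt_nonneg _
  refine ⟨min (c₁ / 2) γ, lt_min (by positivity) hγ, PrimaryMesh.dualConst k Λ + (κ + 1),
    by positivity, fun p q r h => ?_⟩
  obtain ⟨Q, hQ0, hQ⟩ := exists_ae_bound h.memLp_q
  obtain ⟨R, hR0, hR⟩ := exists_ae_bound h.memLp_r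
  have hC : 0 < jumpConst (Λ ^ 2 * k) + 1 := by unfold jumpConst; positivity
  set ε := p₀ / (2 * k * (jumpConst (Λ ^ 2 * k) + 1)) with hε
  have hε0 : 0 < ε := by positivity
  obtain ⟨δ, hδ0, hδ⟩ := Metric.uniformContinuousOn_iff.1
    (isCompact_Icc.uniformContinuousOn_of_continuous h.continuousOn_p) ε hε0
  -- The mesh is fine if `p` varies by at most `ε` over an element, and if `√h ≤ s`, where `s` is
  -- such that the lower order perturbation uses up at most half of the leading term.
  set s := c₁ / (2 * (κ * (Q + R) + 1)) with hs
  have hs0 : 0 < s := by positivity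
  refine ⟨min (min δ 1) (s ^ 2), by positivity, fun T hT w hw =>
    ⟨_, PrimaryMesh.testOfTrial_mem (D := D) hk (PrimaryMesh.oscConst k Λ) hw, ?_, ?_, ?_⟩⟩
  · have hb := PrimaryMesh.bilin_testOfTrial_ge hk hΛ0 hΛ hp₀ h hQ hR hQ0 hR0
      (fun x hx y hy hxy => (hδ x hx y hy (by
        rw [Real.dist_eq]
        exact hxy.trans_lt (hT.trans_le ((min_le_left _ _).trans (min_le_left _ _))))).le) hw
    refine le_trans ?_ hb
    have h1 : Real.sqrt T.meshSize ≤ s :=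
      (Real.sqrt_le_left hs0.le).2 (hT.le.trans (min_le_right _ _))
    have h2 : κ * (Q + R) * Real.sqrt T.meshSize ≤ c₁ / 2 := by
      have h3 : 0 ≤ κ * (Q + R) := by positivity
      refine (mul_le_mul_of_nonneg_left h1 h3).trans ?_
      rw [hs, ← mul_div_assoc, div_le_iff₀ (by positivity)]
      nlinarith
    have h4 := mul_le_mul_of_nonneg_right h2 (sq_nonneg (seminorm w))
    have h5 : 0 ≤ ∫ x in (0 : ℝ)..1, w x ^ 2 :=
      intervalIntegral.integral_nonneg zero_le_one fun _ _ => sq_nonneg _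
    have h6 := mul_le_mul_of_nonneg_right (min_le_left (c₁ / 2) γ) (sq_nonneg (seminorm w))
    have h7 := mul_le_mul_of_nonneg_right (min_le_right (c₁ / 2) γ) h5
    rw [h1Norm_sq]
    linarith
  · have hh : T.meshSize ≤ 1 := hT.le.trans ((min_le_left _ _).trans (min_le_right _ _))
    refine (PrimaryMesh.dualNorm_testOfTrial_le hk hΛ0 hΛ hw hh).trans ?_
    exact mul_le_mul (by linarith) (seminorm_le_h1Norm w) (seminorm_nonneg w) (by positivity)
  · intro i j
    have hh : T.meshSize ≤ 1 := hT.le.trans ((min_le_left _ _).trans (min_le_right _ _))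
    refine (PrimaryMesh.abs_testOfTrial_le hk hΛ0 hΛ (PrimaryMesh.oscConst_nonneg k Λ) hw hh
      i j).trans ?_
    exact mul_le_mul (by linarith) (seminorm_le_h1Norm w) (seminorm_nonneg w) (by positivity)

theorem surjective_of_injective_of_finrank_le {E U V : Type*} [AddCommGroup E] [Module ℝ E]
    [AddCommGroup U] [Module ℝ U] [AddCommGroup V] [Module ℝ V] [FiniteDimensional ℝ E]
    [FiniteDimensional ℝ V] (A : U →ₗ[ℝ] Module.Dual ℝ V) (Ψ : E →ₗ[ℝ] U)
    (hA : Function.Injective A) (hΨ : Function.Injective Ψ)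
    (h : Module.finrank ℝ V ≤ Module.finrank ℝ E) : Function.Surjective A := by
  have hc : Function.Injective (A ∘ₗ Ψ) := hA.comp hΨ
  have h1 := LinearMap.finrank_le_finrank_of_injective hc
  have h2 : Module.finrank ℝ E = Module.finrank ℝ (Module.Dual ℝ V) :=
    le_antisymm h1 (Subspace.dual_finrank_eq.trans_le h)
  exact Function.Surjective.of_comp
    ((LinearMap.injective_iff_surjective_of_finrank_eq_finrank h2).1 hc)

namespace PrimaryMesh

variable {T : PrimaryMesh} {k : ℕ} {D : SymmetricDualPoints k}

/-! ### Trial functions from piecewise polynomials -/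

variable (T) in
/-- The projection of the real line onto an element. -/
def clamp (i : Fin T.N) (x : ℝ) : ℝ := max (T.x i.castSucc) (min (T.x i.succ) x)

theorem clamp_of_le (i : Fin T.N) {x : ℝ} (hx : x ≤ T.x i.castSucc) :
    T.clamp i x = T.x i.castSucc := by
  rw [clamp, min_eq_right (hx.trans (T.x_lt i).le), max_eq_left hx]

theorem clamp_of_ge (i : Fin T.N) {x : ℝ} (hx : T.x i.succ ≤ x) : T.clamp i x = T.x i.succ := by
  rw [clamp, min_eq_left hx, max_eq_right (T.x_lt i).le]

theorem clamp_of_mem (i : Fin T.N) {x : ℝ} (hx : x ∈ T.element i) : T.clamp i x = x := by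
  rw [clamp, min_eq_right hx.2, max_eq_right hx.1]

theorem clamp_eq_of_ne {i m : Fin T.N} (h : m ≠ i) {x : ℝ} (hx : x ∈ T.element i) :
    T.clamp m x = T.clamp m (T.x i.castSucc) := by
  rcases lt_or_gt_of_ne h with h | h
  · have h1 : T.x m.succ ≤ T.x i.castSucc :=
      T.strictMono.monotone (Fin.le_def.2 (by simpa using h))
    rw [clamp_of_ge m h1, clamp_of_ge m (h1.trans hx.1)]
  · have h1 : T.x i.succ ≤ T.x m.castSucc :=
      T.strictMono.monotone (Fin.le_def.2 (by simpa using h))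
    rw [clamp_of_le m (hx.2.trans h1), clamp_of_le m ((T.x_lt i).le.trans h1)]

variable (T k) in
/-- The continuous function which vanishes for `x ≤ 0`, grows by `(x - x_{i-1}) R_i(x)` on the
`i`-th element, and is constant for `x ≥ 1`. -/
def glue : (Fin T.N → Polynomial.degreeLT ℝ k) →ₗ[ℝ] (ℝ → ℝ) where
  toFun R x := ∑ i, (T.clamp i x - T.x i.castSucc) * (R i).1.eval (T.clamp i x)
  map_add' R S := by
    funext x
    simp [mul_add, Finset.sum_add_distrib]
  map_smul' c R := by
    funext x
    simp only [Pi.smul_apply, Submodule.coe_smul, Polynomial.eval_smul, smul_eq_mul,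
      RingHom.id_apply, Finset.mul_sum]
    exact Finset.sum_congr rfl fun i _ => by ring

theorem glue_apply (R : Fin T.N → Polynomial.degreeLT ℝ k) (x : ℝ) :
    glue T k R x = ∑ i, (T.clamp i x - T.x i.castSucc) * (R i).1.eval (T.clamp i x) := rfl

theorem glue_of_mem (R : Fin T.N → Polynomial.degreeLT ℝ k) (i : Fin T.N) {x : ℝ}
    (hx : x ∈ T.element i) :
    glue T k R x = glue T k R (T.x i.castSucc) + (x - T.x i.castSucc) * (R i).1.eval x := by
  rw [glue_apply, glue_apply, ← Finset.add_sum_erase _ _ (Finset.mem_univ i),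
    ← Finset.add_sum_erase _ _ (Finset.mem_univ i),
    Finset.sum_congr rfl fun m hm => by rw [clamp_eq_of_ne (Finset.ne_of_mem_erase hm) hx],
    clamp_of_mem i hx, clamp_of_le i le_rfl]
  ring

theorem glue_of_nonpos (R : Fin T.N → Polynomial.degreeLT ℝ k) {x : ℝ} (hx : x ≤ 0) :
    glue T k R x = 0 := by
  rw [glue_apply]
  refine Finset.sum_eq_zero fun i _ => ?_
  rw [clamp_of_le i (hx.trans (T.x_nonneg _)), sub_self, zero_mul]

theorem glue_of_one_le (R : Fin T.N → Polynomial.degreeLT ℝ k) {x : ℝ} (hx : 1 ≤ x) :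
    glue T k R x = glue T k R 1 := by
  rw [glue_apply, glue_apply]
  refine Finset.sum_congr rfl fun i _ => ?_
  rw [clamp_of_ge i ((T.x_le_one _).trans hx), clamp_of_ge i (T.x_le_one _)]

theorem continuous_glue (R : Fin T.N → Polynomial.degreeLT ℝ k) : Continuous (glue T k R) := by
  have hc : ∀ i, Continuous (T.clamp i) := fun i =>
    continuous_const.max (continuous_const.min continuous_id)
  have hp : ∀ i, Continuous fun x => (R i).1.eval (T.clamp i x) := fun i =>
    (Polynomial.continuous _).comp (hc i)
  show Continuous fun x => ∑ i, (T.clamp i x - T.x i.castSucc) * (R i).1.eval (T.clamp i x)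
  fun_prop

theorem glue_injective : Function.Injective (glue T k) := by
  rw [← LinearMap.ker_eq_bot, LinearMap.ker_eq_bot']
  intro R hR
  funext i
  refine Subtype.ext (Polynomial.eq_zero_of_infinite_isRoot _ ?_)
  -- On each element the glued function is its value at the left end plus `(x - x_{i-1}) R_i(x)`.
  refine (Ioo_infinite (T.x_lt i)).mono fun x hx => ?_
  have h := glue_of_mem R i (Ioo_subset_Icc_self hx)
  rw [hR] at h
  simp only [Pi.zero_apply, zero_add] at h
  exact (mul_eq_zero.1 h.symm).resolve_left (sub_pos.2 hx.1).ne'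

variable (T k) in
/-- The value at `1` of the glued function. -/
def glueEnd : (Fin T.N → Polynomial.degreeLT ℝ k) →ₗ[ℝ] ℝ := LinearMap.proj (1 : ℝ) ∘ₗ glue T k

theorem glue_mem (hk : 0 < k) {R : Fin T.N → Polynomial.degreeLT ℝ k}
    (hR : R ∈ LinearMap.ker (glueEnd T k)) : glue T k R ∈ T.trialSpace k := by
  have h1 : glue T k R 1 = 0 := hR
  refine ⟨continuous_glue R, fun x hx => ?_, fun i =>
    ⟨Polynomial.C (glue T k R (T.x i.castSucc)) +
      (Polynomial.X - Polynomial.C (T.x i.castSucc)) * (R i).1, ?_, fun x hx => ?_⟩⟩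
  · rcases le_or_gt x 0 with h | h
    · exact glue_of_nonpos R h
    · rw [glue_of_one_le R (not_lt.1 fun h' => hx ⟨h, h'⟩), h1]
  · have h2 : (R i).1.natDegree < k := by
      rcases eq_or_ne (R i).1 0 with h0 | h0
      · rw [h0]; simpa using hk
      · exact (Polynomial.natDegree_lt_iff_degree_lt h0).2 (Polynomial.mem_degreeLT.1 (R i).2)
    refine (Polynomial.natDegree_C_add).le.trans (Polynomial.natDegree_mul_le.trans ?_)
    rw [Polynomial.natDegree_X_sub_C]
    omega
  · rw [glue_of_mem R i hx]
    simp

theorem finrank_ker_glueEnd : T.N * k ≤ Module.finrank ℝ (LinearMap.ker (glueEnd T k)) + 1 := by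
  have h1 := LinearMap.finrank_range_add_finrank_ker (glueEnd T k)
  have h2 : Module.finrank ℝ (Fin T.N → Polynomial.degreeLT ℝ k) = T.N * k := by
    rw [Module.finrank_pi_fintype]
    simp [(Polynomial.degreeLTEquiv ℝ k).finrank_eq]
  have h3 : Module.finrank ℝ (LinearMap.range (glueEnd T k)) ≤ 1 := by
    simpa using Submodule.finrank_le (LinearMap.range (glueEnd T k))
  omega

theorem finrank_testSpace_lt (hk : 0 < k) : Module.finrank ℝ (T.testSpace k) < T.N * k := by
  have h1 : T.testSpace k ≠ ⊤ := fun h => by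
    have h2 : (fun _ _ => 1 : Fin T.N → Fin k → ℝ) ∈ T.testSpace k := by rw [h]; trivial
    have h3 := h2 ⟨T.N - 1, Nat.sub_lt T.N_pos one_pos⟩ ⟨k - 1, Nat.sub_lt hk one_pos⟩
      (Nat.sub_add_cancel T.N_pos) (Nat.sub_add_cancel hk)
    exact one_ne_zero h3
  refine (Submodule.finrank_lt h1).trans_eq ?_
  simp [Module.finrank_pi_fintype]

/-! ### The scheme as a linear system -/

section Bilinear

variable {p q r : ℝ → ℝ}

theorem prevVal_add (v v' : Fin T.N → Fin k → ℝ) (i : Fin T.N) (j : Fin k) :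
    prevVal (v + v') i j = prevVal v i j + prevVal v' i j := by
  unfold prevVal
  split_ifs <;> simp

theorem prevVal_smul (c : ℝ) (v : Fin T.N → Fin k → ℝ) (i : Fin T.N) (j : Fin k) :
    prevVal (c • v) i j = c * prevVal v i j := by
  unfold prevVal
  split_ifs <;> simp

theorem bilin_add_right (w : ℝ → ℝ) (v v' : Fin T.N → Fin k → ℝ) :
    T.bilin D p q r w (v + v') = T.bilin D p q r w v + T.bilin D p q r w v' := by
  unfold bilin jump
  simp only [prevVal_add, Pi.add_apply]
  rw [add_add_add_comm]
  simp only [← Finset.sum_add_distrib]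
  exact Finset.sum_congr rfl fun i _ => Finset.sum_congr rfl fun j _ => by ring

theorem bilin_smul_right (c : ℝ) (w : ℝ → ℝ) (v : Fin T.N → Fin k → ℝ) :
    T.bilin D p q r w (c • v) = c * T.bilin D p q r w v := by
  unfold bilin jump
  simp only [prevVal_smul, Pi.smul_apply, smul_eq_mul, mul_add, Finset.mul_sum]
  congr 1 <;> exact Finset.sum_congr rfl fun i _ => Finset.sum_congr rfl fun j _ => by ring

theorem differentiableAt_dualPt (hk : 0 < k) {w : ℝ → ℝ} (hw : w ∈ T.trialSpace k) (i : Fin T.N)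
    (j : Fin k) : DifferentiableAt ℝ w (T.dualPt D i j) := by
  obtain ⟨R, -, hR⟩ := exists_deriv_poly hk hw i
  exact (hR _ (T.dualPt_mem_Ioo D i j)).differentiableAt

theorem bilin_add_left (hk : 0 < k) (hq : MemLp q ⊤ (volume.restrict (Ioo (0 : ℝ) 1)))
    (hr : MemLp r ⊤ (volume.restrict (Ioo (0 : ℝ) 1))) {w w' : ℝ → ℝ} (hw : w ∈ T.trialSpace k)
    (hw' : w' ∈ T.trialSpace k) (v : Fin T.N → Fin k → ℝ) :
    T.bilin D p q r (w + w') v = T.bilin D p q r w v + T.bilin D p q r w' v := by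
  have hpw := piecewiseC1_of_mem hk hw
  have hpw' := piecewiseC1_of_mem hk hw'
  have h1 : ∀ i j, deriv (w + w') (T.dualPt D i j) =
      deriv w (T.dualPt D i j) + deriv w' (T.dualPt D i j) := fun i j =>
    deriv_add (differentiableAt_dualPt hk hw i j) (differentiableAt_dualPt hk hw' i j)
  have h2 : ∀ i j, ∫ x in (T.dualPt D i j)..(T.dualPtNext D i j),
      (q x * deriv (w + w') x + r x * (w + w') x) =
      (∫ x in (T.dualPt D i j)..(T.dualPtNext D i j), (q x * deriv w x + r x * w x)) +
        ∫ x in (T.dualPt D i j)..(T.dualPtNext D i j), (q x * deriv w' x + r x * w' x) := by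
    intro i j
    rw [← intervalIntegral.integral_add
      (intervalIntegrable_of_mem (hpw.intervalIntegrable_lower hq hr)
        (T.dualPt_mem_Icc D i j) (dualPtNext_mem_Icc i j))
      (intervalIntegrable_of_mem (hpw'.intervalIntegrable_lower hq hr)
        (T.dualPt_mem_Icc D i j) (dualPtNext_mem_Icc i j))]
    obtain ⟨M, -, hM⟩ := hpw.exists_ae_deriv_bound
    obtain ⟨M', -, hM'⟩ := hpw'.exists_ae_deriv_bound
    refine intervalIntegral.integral_congr_ae ?_
    filter_upwards [hM, hM'] with x hx hx' _
    rw [deriv_add hx.1 hx'.1, Pi.add_apply]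
    ring
  unfold bilin
  simp only [h1, h2]
  rw [add_add_add_comm]
  simp only [← Finset.sum_add_distrib]
  exact Finset.sum_congr rfl fun i _ => Finset.sum_congr rfl fun j _ => by ring

theorem bilin_smul_left (c : ℝ) (w : ℝ → ℝ) (v : Fin T.N → Fin k → ℝ) :
    T.bilin D p q r (c • w) v = c * T.bilin D p q r w v := by
  have h1 : ∀ x, deriv (c • w) x = c * deriv w x := fun x => by
    rw [deriv_const_smul_field, smul_eq_mul]
  have h2 : ∀ x, q x * (c * deriv w x) + r x * (c * w x) = c * (q x * deriv w x + r x * w x) :=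
    fun x => by ring
  unfold bilin
  simp only [h1, Pi.smul_apply, smul_eq_mul, h2, intervalIntegral.integral_const_mul]
  rw [mul_add]
  simp only [Finset.mul_sum]
  congr 1 <;> exact Finset.sum_congr rfl fun i _ => Finset.sum_congr rfl fun j _ => by ring

variable (T D) in
/-- The bilinear form of the scheme, as a linear map from the trial space to the dual of the test
space. -/
def bilinMap (hk : 0 < k) {p₀ γ : ℝ} (h : AdmissibleCoefficients p₀ γ p q r) :
    T.trialSpace k →ₗ[ℝ] Module.Dual ℝ (T.testSpace k) :=
  LinearMap.mk₂ ℝ (fun w v => T.bilin D p q r w.1 v.1)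
    (fun w w' v => bilin_add_left hk h.memLp_q h.memLp_r w.2 w'.2 v.1)
    (fun c w v => bilin_smul_left c w.1 v.1)
    (fun w v v' => bilin_add_right w.1 v.1 v'.1)
    (fun c w v => bilin_smul_right c w.1 v.1)

/-- The trial space is large enough: it contains a space whose dimension is at least that of the
test space, so that uniqueness implies existence. -/
theorem bilinMap_surjective (hk : 0 < k) {p₀ γ : ℝ} (h : AdmissibleCoefficients p₀ γ p q r)
    (hinj : Function.Injective (bilinMap T D hk h)) :
    Function.Surjective (bilinMap T D hk h) := by
  let Ψ : LinearMap.ker (glueEnd T k) →ₗ[ℝ] T.trialSpace k :=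
    ((glue T k).domRestrict _).codRestrict _ fun R => glue_mem hk R.2
  have hΨ : Function.Injective Ψ := fun R S hRS =>
    Subtype.ext (glue_injective (congrArg Subtype.val hRS))
  have h2 := finrank_ker_glueEnd (T := T) (k := k)
  have h3 := finrank_testSpace_lt (T := T) hk
  have h4 : Module.finrank ℝ (T.testSpace k) ≤
      Module.finrank ℝ (LinearMap.ker (glueEnd T k)) := by omega
  exact surjective_of_injective_of_finrank_le (E := LinearMap.ker (glueEnd T k))
    (bilinMap T D hk h) Ψ hinj hΨ h4

end Bilinear

variable (D) in
/-- The right-hand side of the scheme. -/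
def load {f : ℝ → ℝ} (hf : IntervalIntegrable f volume 0 1) : Module.Dual ℝ (T.testSpace k) where
  toFun v := ∫ x in (0 : ℝ)..1, f x * T.testFun D v.1 x
  map_add' v v' := by
    simp only [integral_mul_testFun hf, Submodule.coe_add, Pi.add_apply, add_mul,
      Finset.sum_add_distrib]
  map_smul' c v := by
    simp only [integral_mul_testFun hf, Submodule.coe_smul, Pi.smul_apply, smul_eq_mul, mul_assoc,
      Finset.mul_sum, RingHom.id_apply]

theorem dualNorm_pos {v : Fin T.N → Fin k → ℝ} (hv : v ≠ 0) : 0 < T.dualNorm v := by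
  obtain ⟨i, hi⟩ := Function.ne_iff.1 hv
  obtain ⟨j, hj⟩ := Function.ne_iff.1 hi
  refine Real.sqrt_pos.2 (add_pos_of_nonneg_of_pos ?_ ?_)
  · exact Finset.sum_nonneg fun i _ => Finset.sum_nonneg fun j _ =>
      mul_nonneg (inv_pos.2 (T.len_pos i)).le (sq_nonneg _)
  · have h0 : ∀ i j, 0 ≤ T.len i * v i j ^ 2 := fun i j =>
      mul_nonneg (T.len_pos i).le (sq_nonneg _)
    refine Finset.sum_pos' (fun i _ => Finset.sum_nonneg fun j _ => h0 i j)
      ⟨i, Finset.mem_univ i, Finset.sum_pos' (fun j _ => h0 i j) ⟨j, Finset.mem_univ j, ?_⟩⟩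
    exact mul_pos (T.len_pos i) (sq_pos_of_ne_zero hj)

theorem integral_mul_testFun_le (hk : 0 < k) {f : ℝ → ℝ} (hf : IntervalIntegrable f volume 0 1)
    (hf2 : IntervalIntegrable (fun x => f x ^ 2) volume 0 1) {v : Fin T.N → Fin k → ℝ} {B : ℝ}
    (hB : 0 ≤ B) (hv : ∀ i j, |v i j| ≤ B) :
    ∫ x in (0 : ℝ)..1, f x * T.testFun D v x ≤ B * l2Norm f := by
  have h1 : ∫ x in (0 : ℝ)..1, |f x| ≤ l2Norm f := by
    refine Real.le_sqrt_of_sq_le ?_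
    have h := sq_integral_le zero_le_one hf.abs (by simpa only [sq_abs] using hf2)
    simpa only [sq_abs, sub_zero, one_mul] using h
  refine le_trans ?_ (mul_le_mul_of_nonneg_left h1 hB)
  rw [integral_mul_testFun hf, ← sum_integral_dual (T := T) (D := D) hk hf.abs]
  have h0 : 0 ≤ ∫ x in (0 : ℝ)..(T.dualPt D ⟨0, T.N_pos⟩ ⟨0, hk⟩), |f x| :=
    intervalIntegral.integral_nonneg (T.dualPt_mem_Icc D _ _).1 fun _ _ => abs_nonneg _
  refine le_trans ?_ (mul_le_mul_of_nonneg_left (le_add_of_nonneg_left h0) hB)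
  simp only [Finset.mul_sum]
  refine Finset.sum_le_sum fun i _ => Finset.sum_le_sum fun j _ => ?_
  refine (le_abs_self _).trans ?_
  rw [abs_mul]
  exact mul_le_mul (hv i j)
    (intervalIntegral.abs_integral_le_integral_abs (T.dualPtNext_bounds D i j).1)
    (abs_nonneg _) hB

theorem h1Norm_pos (hk : 0 < k) {w : ℝ → ℝ} (hw : w ∈ T.trialSpace k) (hw0 : w ≠ 0) :
    0 < h1Norm w := by
  refine (h1Norm_nonneg w).lt_of_ne fun h => hw0 (funext fun x => ?_)
  have hpw := piecewiseC1_of_mem hk hw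
  by_cases hx : x ∈ Ioo (0 : ℝ) 1
  · have h1 := (hpw.abs_le hx.1.le hx.2.le).trans (seminorm_le_h1Norm w)
    rw [← h] at h1
    exact abs_nonpos_iff.1 h1
  · exact hpw.zero_outside x hx

end PrimaryMesh

end FVE

end

theorem mainTheorem4 (k : ℕ) (hk : 1 ≤ k) (D : FVE.SymmetricDualPoints k)
    (p₀ γ : ℝ) (hp₀ : 0 < p₀) (hγ : 0 < γ) :
    ∃ c₀ : ℝ, 0 < c₀ ∧ ∃ C : ℝ, 0 < C ∧
      ∀ p q r : ℝ → ℝ, FVE.AdmissibleCoefficients p₀ γ p q r →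
        ∃ h₀ : ℝ, 0 < h₀ ∧ ∀ T : FVE.PrimaryMesh, T.meshSize < h₀ →
          ((c₀ : EReal) ≤
            ⨅ w ∈ {w | w ∈ T.trialSpace k ∧ w ≠ 0},
              ⨆ v ∈ {v | v ∈ T.testSpace k ∧ v ≠ 0},
                ((T.bilin D p q r w v / (FVE.h1Norm w * T.dualNorm v) : ℝ) : EReal)) ∧
          ∀ f : ℝ → ℝ, MemLp f 2 (volume.restrict (Ioo (0 : ℝ) 1)) →
            ∃ u : ℝ → ℝ,
              (u ∈ T.trialSpace k ∧
                ∀ v ∈ T.testSpace k,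
                  T.bilin D p q r u v = ∫ x in (0 : ℝ)..1, f x * T.testFun D v x) ∧
              (∀ u' ∈ T.trialSpace k,
                (∀ v ∈ T.testSpace k,
                  T.bilin D p q r u' v = ∫ x in (0 : ℝ)..1, f x * T.testFun D v x) → u' = u) ∧
              FVE.h1Norm u ≤ C * FVE.l2Norm f := by
  obtain ⟨c, hc, K, hK, h⟩ := FVE.exists_coercive_test hk D hp₀ hγ
  refine ⟨c / K, div_pos hc hK, K / c, div_pos hK hc, fun p q r hpqr => ?_⟩
  obtain ⟨h₀, hh₀, htest⟩ := h p q r hpqr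
  refine ⟨h₀, hh₀, fun T hT => ⟨?_, fun f hf => ?_⟩⟩
  · refine le_iInf₂ fun w hw => ?_
    obtain ⟨v, hv, hcv, hdual, -⟩ := htest T hT w hw.1
    have hw0 := FVE.PrimaryMesh.h1Norm_pos hk hw.1 hw.2
    have hpos : 0 < T.bilin D p q r w v := lt_of_lt_of_le (by positivity) hcv
    have hv0 : v ≠ 0 := by
      rintro rfl
      have h0 := FVE.PrimaryMesh.bilin_smul_right (D := D) (p := p) (q := q) (r := r) 0 w
        (0 : Fin T.N → Fin k → ℝ)
      rw [zero_smul, zero_mul] at h0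
      exact hpos.ne' h0
    refine le_iSup₂_of_le v ⟨hv, hv0⟩ (EReal.coe_le_coe_iff.2 ?_)
    have hd := FVE.PrimaryMesh.dualNorm_pos hv0
    rw [div_le_div_iff₀ hK (by positivity)]
    calc c * (FVE.h1Norm w * T.dualNorm v) ≤ c * (FVE.h1Norm w * (K * FVE.h1Norm w)) := by gcongr
      _ = c * FVE.h1Norm w ^ 2 * K := by ring
      _ ≤ T.bilin D p q r w v * K := by gcongr
  · have hinj : Function.Injective (FVE.PrimaryMesh.bilinMap T D hk hpqr) := by
      rw [← LinearMap.ker_eq_bot, LinearMap.ker_eq_bot']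
      intro w hw
      by_contra hw0
      have hw1 := FVE.PrimaryMesh.h1Norm_pos hk w.2 fun h => hw0 (Subtype.ext h)
      obtain ⟨v, hv, hcv, -, -⟩ := htest T hT w.1 w.2
      have h1 : T.bilin D p q r w.1 v = 0 := LinearMap.congr_fun hw ⟨v, hv⟩
      rw [h1] at hcv
      exact absurd hcv (not_le.2 (by positivity))
    have hf' : MemLp f 2 (volume.restrict (Ioc (0 : ℝ) 1)) := by
      rwa [restrict_Ioo_eq_restrict_Ioc] at hf
    have hf1 : IntervalIntegrable f volume 0 1 :=
      (intervalIntegrable_iff_integrableOn_Ioc_of_le zero_le_one).2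
        (hf'.integrable (by norm_num))
    have hf2 : IntervalIntegrable (fun x => f x ^ 2) volume 0 1 :=
      (intervalIntegrable_iff_integrableOn_Ioc_of_le zero_le_one).2 hf'.integrable_sq
    obtain ⟨u, hu⟩ := FVE.PrimaryMesh.bilinMap_surjective hk hpqr hinj
      (FVE.PrimaryMesh.load D hf1)
    have hu' : ∀ v ∈ T.testSpace k,
        T.bilin D p q r u.1 v = ∫ x in (0 : ℝ)..1, f x * T.testFun D v x := fun v hv =>
      LinearMap.congr_fun hu ⟨v, hv⟩
    refine ⟨u.1, ⟨u.2, hu'⟩, fun w hw hwv => ?_, ?_⟩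
    · have h1 : FVE.PrimaryMesh.bilinMap T D hk hpqr ⟨w, hw⟩ =
          FVE.PrimaryMesh.bilinMap T D hk hpqr u :=
        LinearMap.ext fun v => (hwv v.1 v.2).trans (hu' v.1 v.2).symm
      exact congrArg Subtype.val (hinj h1)
    · obtain ⟨v, hv, hcv, -, hvB⟩ := htest T hT u.1 u.2
      have hn := FVE.h1Norm_nonneg u.1
      rw [hu' v hv] at hcv
      have h1 := hcv.trans
        (FVE.PrimaryMesh.integral_mul_testFun_le hk hf1 hf2 (mul_nonneg hK.le hn) hvB)
      rcases hn.eq_or_lt with h0 | h0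
      · rw [← h0]
        exact mul_nonneg (div_pos hK hc).le (Real.sqrt_nonneg _)
      · rw [div_mul_eq_mul_div, le_div_iff₀ hc]
        refine le_of_mul_le_mul_right ?_ h0
        linarith
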